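/- Let $k$ be a field, $\lambda\in k$, let $X$ be a well-ordered set, and let $\Omega=\bigcup_{m\ge1}\Omega_m$ be a well-ordered set of operation symbols, where the symbols in $\Omega_m$ are $m$-ary. Algebras are not assumed unital. *Algebras.* A $\lambda$-differential associative (resp. Lie) $\Omega$-algebra over $k$ is an associative (resp. Lie) $k$-algebra with a linear operator $D$ satisfying $D(x\cdot y)=D(x)\cdot y+x\cdot D(y)+\lambda D(x)\cdot D(y)$ (where $\cdot$ is the product, resp. the Lie bracket) and with an $m$-linear operator $\omega$ for each $\omega\in\Omega_m$, $m\ge 1$. Homomorphisms commute with $D$ and with all $\omega\in\Omega$. *Words.* For a set $Y$ let $\Delta(Y)=\{D^i(y): i\ge0,\ y\in Y\}$, let $\Omega(Y)=\{\omega(y_1,\dots,y_m): m\ge1,\ \omega\in\Omega_m,\ y_j\in Y\}$, and let $S(Y)$ be the set of nonempty associative words on $Y$. The set $\langle D,\Omega;X\rangle$ of differential associative words is the smallest set $W$ with $W=S(\Delta(X\cup\Omega(W)))$; the elements of $\Delta(X\cup\Omega(W))$ are called prime. Let $DA\langle\Omega;X\rangle$ be the semigroup algebra of $\langle D,\Omega;X\rangle$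 over $k$, with the operators $\omega$ extended multilinearly, and with $D$ the linear operator given by $D(D^i(u'))=D^{i+1}(u')$ for $u'\in X\cup\Omega(W)$ and $D(u_1\cdots u_t)=D(u_1)(u_2\cdots u_t)+u_1D(u_2\cdots u_t)+\lambda D(u_1)D(u_2\cdots u_t)$ for prime $u_j$ and $t>1$. It is a $\lambda$-differential associative $\Omega$-algebra, hence a $\lambda$-differential Lie $\Omega$-algebra under $[a,b]=ab-ba$. Let $DLie(\Omega;X)$ be the $\lambda$-differential Lie $\Omega$-subalgebra of it generated by $X$. *Order.* Let $\deg u$ be the number of occurrences of elements of $X$, of $\Omega$ and of $D$ in $u$. For prime $u_i,v_j$, the words $u_1\cdots u_n$ and $v_1\cdots v_m$ are compared by degree, then by the number of prime factors, then by the prime factors lexicographically from left to right. Prime words are compared by degree; if the degrees are equal, elements of $X$ are compared as in $X$, and $\omega(u_1,\dots,u_t)$, $\theta(v_1,\dots,v_l)$ with $\omega,\theta\in\{D\}\cup\Omega$ are compared by their outermost symbols, where $D$ is smaller than every element of $\Omega$, and then by their arguments lexicographically. *Lyndon–Shirshov words.* For a totally ordered alphabet $Z$, extend the order to words lexicographically,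 with the empty word greater than every nonempty word. A nonempty word $w$ on $Z$ is an associative Lyndon–Shirshov word if $uv>vu$ whenever $w=uv$ with $u,v$ nonempty. A nonassociative word on $Z$ is in $NLSW(Z)$ if its underlying associative word is an associative Lyndon–Shirshov word and, when it is a product $(v)(w)$, both $(v)$ and $(w)$ are in $NLSW(Z)$ and, if moreover $(v)=(v_1)(v_2)$, then $v_2\le w$ for the underlying words. Put $NLSW(D,\Omega;X)_0=NLSW(\Delta(X))$ and $NLSW(D,\Omega;X)_n=NLSW\big(\Delta(X\cup\Omega(NLSW(D,\Omega;X)_{n-1}))\big)$ for $n\ge1$, where letters are compared by erasing all brackets in them and comparing the resulting prime words in the order above. Let $NLSW(D,\Omega;X)=\bigcup_{n\ge0}NLSW(D,\Omega;X)_n$; its elements are read as elements of $DA\langle\Omega;X\rangle$ by interpreting products as commutators. **Theorem.** $DLie(\Omega;X)$ is a free $\lambda$-differential Lie $\Omega$-algebra on the set $X$: every map from $X$ to a $\lambda$-differential Lie $\Omega$-algebra $L$ extends to a unique homomorphism $DLie(\Omega;X)\to L$ of $\lambda$-differential Lie $\Omega$-algebras. Moreover $NLSW(D,\Omega;X)$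 is a $k$-linear basis of $DLie(\Omega;X)$. -/

import Mathlib

universe u v w z

namespace DiffLie

/-! ### Differential associative and nonassociative words

`X` is the set of generators, `Ω` the set of operation symbols, `ar ω` the arity of `ω`. -/

/-- Prime differential words: the elements of `Δ(X ∪ Ω(⟨D, Ω; X⟩))`, that is the expressions
`D^i(x)` and `D^i(ω(u₁, …, u_m))` with differential associative words `u₁, …, u_m`. -/
inductive Letter (X : Type u) {Ω : Type v} (ar : Ω → ℕ) : Type (max u v)
  | gen (x : X) : Letter X ar
  | op (ω : Ω) (a : Fin (ar ω) → FreeSemigroup (Letter X ar)) : Letter X ar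
  | diff (p : Letter X ar) : Letter X ar

/-- Differential associative words `⟨D, Ω; X⟩`: nonempty associative words in prime words. -/
abbrev Word (X : Type u) {Ω : Type v} (ar : Ω → ℕ) : Type (max u v) :=
  FreeSemigroup (Letter X ar)

/-- Bracketed prime words: the expressions `D^i(x)` and `D^i(ω(u₁, …, u_m))` with differential
nonassociative words `u₁, …, u_m`. -/
inductive NLetter (X : Type u) {Ω : Type v} (ar : Ω → ℕ) : Type (max u v)
  | gen (x : X) : NLetter X ar
  | op (ω : Ω) (a : Fin (ar ω) → FreeMagma (NLetter X ar)) : NLetter X ar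
  | diff (p : NLetter X ar) : NLetter X ar

/-- Differential nonassociative words `(D, Ω; X)`: nonassociative words in bracketed prime
words. -/
abbrev NWord (X : Type u) {Ω : Type v} (ar : Ω → ℕ) : Type (max u v) :=
  FreeMagma (NLetter X ar)

/-- The list of letters of a nonempty associative word. -/
def letters {α : Type u} (w : FreeSemigroup α) : List α := w.head :: w.tail

/-- The list of letters of a nonassociative word, that is the word without its brackets. -/
def flat {α : Type u} : FreeMagma α → List α
  | .of a => [a]
  | .mul v w => flat v ++ flat w

section Words

variable {X : Type u} {Ω : Type v} {ar : Ω → ℕ}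

mutual
/-- Erase all brackets, also those inside the arguments of the operations. -/
def eraseLetter : NLetter X ar → Letter X ar
  | .gen x => .gen x
  | .op ω a => .op ω (fun j => eraseWord (a j))
  | .diff p => .diff (eraseLetter p)
/-- Erase all brackets of a differential nonassociative word. -/
def eraseWord : FreeMagma (NLetter X ar) → FreeSemigroup (Letter X ar)
  | .of p => FreeSemigroup.of (eraseLetter p)
  | .mul v w => eraseWord v * eraseWord w
end

mutual
/-- Number of occurrences of generators, operation symbols and `D` in a prime word. -/
def degLetter : Letter X ar → ℕ
  | .gen _ => 1
  | .op _ a => 1 + ∑ j, degWord (a j)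
  | .diff p => 1 + degLetter p
/-- Number of occurrences of generators, operation symbols and `D` in a word. -/
def degWord : FreeSemigroup (Letter X ar) → ℕ
  | ⟨p, t⟩ => degLetter p + degList t
/-- Number of occurrences of generators, operation symbols and `D` in a list of prime words. -/
def degList : List (Letter X ar) → ℕ
  | [] => 0
  | p :: t => degLetter p + degList t
end

/-! ### The Deg-lex order

Words are compared by degree, then by breadth, then by their prime factors from left to right.
Prime words are compared by degree, then by their outermost symbol (where `D < ω` for all
`ω ∈ Ω`), then by their arguments from left to right. -/

mutual
/-- The Deg-lex order on prime words. -/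
inductive LetterLT [LT X] [LT Ω] : Letter X ar → Letter X ar → Prop
  | deg {p q : Letter X ar} (h : degLetter p < degLetter q) : LetterLT p q
  | gen {x y : X} (h : x < y) : LetterLT (.gen x) (.gen y)
  | diff {p q : Letter X ar} (h : LetterLT p q) : LetterLT (.diff p) (.diff q)
  | diff_op {p : Letter X ar} {ω : Ω} {a : Fin (ar ω) → FreeSemigroup (Letter X ar)}
      (hd : degLetter (.diff p) = degLetter (.op ω a)) : LetterLT (.diff p) (.op ω a)
  | op {ω θ : Ω} {a : Fin (ar ω) → FreeSemigroup (Letter X ar)}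
      {b : Fin (ar θ) → FreeSemigroup (Letter X ar)}
      (hd : degLetter (.op ω a) = degLetter (.op θ b)) (h : ω < θ) :
      LetterLT (.op ω a) (.op θ b)
  | arg {ω : Ω} {a b : Fin (ar ω) → FreeSemigroup (Letter X ar)}
      (hd : degLetter (.op ω a) = degLetter (.op ω b)) (j : Fin (ar ω))
      (heq : ∀ i < j, a i = b i) (h : WordLT (a j) (b j)) : LetterLT (.op ω a) (.op ω b)
/-- The Deg-lex order on differential associative words. -/
inductive WordLT [LT X] [LT Ω] :
    FreeSemigroup (Letter X ar) → FreeSemigroup (Letter X ar) → Prop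
  | deg {u v : FreeSemigroup (Letter X ar)} (h : degWord u < degWord v) : WordLT u v
  | bre {u v : FreeSemigroup (Letter X ar)} (hd : degWord u = degWord v)
      (h : (letters u).length < (letters v).length) : WordLT u v
  | lex {u v : FreeSemigroup (Letter X ar)} (hd : degWord u = degWord v)
      (hl : (letters u).length = (letters v).length) (s t t' : List (Letter X ar))
      (p q : Letter X ar) (hu : letters u = s ++ p :: t) (hv : letters v = s ++ q :: t')
      (h : LetterLT p q) : WordLT u v
end

end Words

/-! ### Lyndon–Shirshov words -/

/-- The lexicographic order `u <_lex v` on words over an alphabet with order `r`, where the empty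
word is greater than every nonempty word. -/
def LexLT {α : Type u} (r : α → α → Prop) : List α → List α → Prop
  | [], _ => False
  | _ :: _, [] => True
  | a :: u, b :: v => r a b ∨ (a = b ∧ LexLT r u v)

/-- Associative Lyndon–Shirshov words: nonempty words `w` with `uv >_lex vu` for all
decompositions `w = uv` into nonempty words. -/
def IsALSW {α : Type u} (r : α → α → Prop) (w : List α) : Prop :=
  w ≠ [] ∧ ∀ u v : List α, u ≠ [] → v ≠ [] → w = u ++ v → LexLT r (v ++ u) (u ++ v)

/-- Nonassociative Lyndon–Shirshov words. -/
def IsNLSW {α : Type u} (r : α → α → Prop) : FreeMagma α → Prop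
  | .of a => IsALSW r [a]
  | .mul v w => IsALSW r (flat v ++ flat w) ∧ IsNLSW r v ∧ IsNLSW r w ∧
      ∀ v₁ v₂ : FreeMagma α, v = .mul v₁ v₂ →
        (flat v₂ = flat w ∨ LexLT r (flat v₂) (flat w))

/-- `NLSW(Z)`: the nonassociative Lyndon–Shirshov words all of whose letters are in `Z`. -/
def NLSWOn {α : Type u} (r : α → α → Prop) (Z : Set α) : Set (FreeMagma α) :=
  {v | (∀ a ∈ flat v, a ∈ Z) ∧ IsNLSW r v}

section NLSW

variable (X : Type u) {Ω : Type v} (ar : Ω → ℕ)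

/-- The order on bracketed prime words induced by the Deg-lex order: `[u] < [v]` if `u < v`. -/
def NLetterLT [LT X] [LT Ω] (p q : NLetter X ar) : Prop :=
  LetterLT (eraseLetter p) (eraseLetter q)

/-- `Δ(X)`. -/
def deltaGen : Set (NLetter X ar) := {p | ∃ (i : ℕ) (x : X), p = NLetter.diff^[i] (.gen x)}

/-- `Δ(Ω(W))` for a set `W` of nonassociative words. -/
def deltaOp (W : Set (NWord X ar)) : Set (NLetter X ar) :=
  {p | ∃ (i : ℕ) (ω : Ω) (a : Fin (ar ω) → NWord X ar),
    (∀ j, a j ∈ W) ∧ p = NLetter.diff^[i] (.op ω a)}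

/-- `NLSW(D, Ω; X)_n`: the nonassociative Lyndon–Shirshov words on `Δ(X)` for `n = 0`, and on
`Δ(X ∪ Ω(NLSW(D, Ω; X)_{n-1}))` for `n > 0`. -/
def NLSWStage [LT X] [LT Ω] : ℕ → Set (NWord X ar)
  | 0 => NLSWOn (NLetterLT X ar) (deltaGen X ar)
  | n + 1 => NLSWOn (NLetterLT X ar) (deltaGen X ar ∪ deltaOp X ar (NLSWStage n))

/-- `NLSW(D, Ω; X)`: the differential nonassociative Lyndon–Shirshov words on `X`. -/
def NLSW [LT X] [LT Ω] : Set (NWord X ar) := ⋃ n, NLSWStage X ar n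

end NLSW

/-! ### Differential algebras with operators -/

/-- A structure of `lam`-differential associative algebra with operators `Ω` on a (not necessarily
unital) associative algebra `R`. -/
structure DiffAssocOmega (k : Type*) [Field k] (lam : k) {Ω : Type*} (ar : Ω → ℕ) (R : Type*)
    [NonUnitalRing R] [Module k R] where
  D : R →ₗ[k] R
  D_mul : ∀ x y : R, D (x * y) = D x * y + x * D y + lam • (D x * D y)
  op : ∀ ω : Ω, MultilinearMap k (fun _ : Fin (ar ω) => R) R

/-- A structure of `lam`-differential Lie algebra with operators `Ω` on a Lie algebra `L`. -/
structure DiffLieOmega (k : Type*) [Field k] (lam : k) {Ω : Type*} (ar : Ω → ℕ) (L : Type*)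
    [LieRing L] [LieAlgebra k L] where
  D : L →ₗ[k] L
  D_lie : ∀ x y : L, D ⁅x, y⁆ = ⁅D x, y⁆ + ⁅x, D y⁆ + lam • ⁅D x, D y⁆
  op : ∀ ω : Ω, MultilinearMap k (fun _ : Fin (ar ω) => L) L

section Commutator

/-- The commutator bracket `xy - yx` on an associative ring without unit. -/
abbrev commLieRing (R : Type*) [NonUnitalRing R] : LieRing R where
  bracket x y := x * y - y * x
  add_lie x y z := by
    change (x + y) * z - z * (x + y) = (x * z - z * x) + (y * z - z * y)
    rw [add_mul, mul_add]; abel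
  lie_add x y z := by
    change x * (y + z) - (y + z) * x = (x * y - y * x) + (x * z - z * x)
    rw [add_mul, mul_add]; abel
  lie_self x := sub_self (x * x)
  leibniz_lie x y z := by
    change x * (y * z - z * y) - (y * z - z * y) * x =
      ((x * y - y * x) * z - z * (x * y - y * x)) + (y * (x * z - z * x) - (x * z - z * x) * y)
    simp only [mul_sub, sub_mul, mul_assoc]; abel

/-- The commutator Lie algebra of an associative algebra without unit. -/
abbrev commLieAlgebra (k R : Type*) [Field k] [NonUnitalRing R] [Module k R]
    [IsScalarTower k R R] [SMulCommClass k R R] : @LieAlgebra k R _ (commLieRing R) :=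
  letI := commLieRing R
  { lie_smul := fun t x y => by
      change x * (t • y) - (t • y) * x = t • (x * y - y * x)
      rw [mul_smul_comm, smul_mul_assoc, smul_sub] }

/-- A `lam`-differential associative algebra with operators is a `lam`-differential Lie algebra
with operators under the commutator. -/
def DiffAssocOmega.toLie {k : Type*} [Field k] {lam : k} {Ω : Type*} {ar : Ω → ℕ} {R : Type*}
    [NonUnitalRing R] [Module k R] [IsScalarTower k R R] [SMulCommClass k R R]
    (A : DiffAssocOmega k lam ar R) :
    @DiffLieOmega k _ lam Ω ar R (commLieRing R) (commLieAlgebra k R) :=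
  letI := commLieRing R
  letI := commLieAlgebra k R
  { D := A.D
    D_lie := fun x y => by
      change A.D (x * y - y * x) = (A.D x * y - y * A.D x) + (x * A.D y - A.D y * x) +
        lam • (A.D x * A.D y - A.D y * A.D x)
      rw [map_sub, A.D_mul, A.D_mul, smul_sub]; abel
    op := A.op }

end Commutator

namespace DiffLieOmega

variable {k : Type*} [Field k] {lam : k} {Ω : Type v} {ar : Ω → ℕ}
  {L : Type*} [LieRing L] [LieAlgebra k L] {M : Type*} [LieRing M] [LieAlgebra k M]

/-- A Lie algebra homomorphism is a homomorphism of `lam`-differential Lie algebras with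
operators if it commutes with `D` and with all operators. -/
def IsHom (A : DiffLieOmega k lam ar L) (B : DiffLieOmega k lam ar M) (φ : L →ₗ⁅k⁆ M) : Prop :=
  (∀ x, φ (A.D x) = B.D (φ x)) ∧
    ∀ (ω : Ω) (a : Fin (ar ω) → L), φ (A.op ω a) = B.op ω (fun j => φ (a j))

/-- A Lie subalgebra is a `lam`-differential Lie subalgebra with operators if it is closed under
`D` and under all operators. -/
def IsClosed (A : DiffLieOmega k lam ar L) (S : LieSubalgebra k L) : Prop :=
  (∀ x ∈ S, A.D x ∈ S) ∧
    ∀ (ω : Ω) (a : Fin (ar ω) → L), (∀ j, a j ∈ S) → A.op ω a ∈ S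

/-- The `lam`-differential Lie subalgebra with operators generated by a set. -/
def closure (A : DiffLieOmega k lam ar L) (s : Set L) : LieSubalgebra k L :=
  sInf {S : LieSubalgebra k L | A.IsClosed S ∧ s ⊆ S}

theorem mem_closure (A : DiffLieOmega k lam ar L) (s : Set L) (x : L) :
    x ∈ A.closure s ↔ ∀ S : LieSubalgebra k L, A.IsClosed S → s ⊆ S → x ∈ S := by
  rw [← SetLike.mem_coe, closure, LieSubalgebra.coe_sInf]
  simp only [Set.mem_iInter, Set.mem_ofPred_eq, SetLike.mem_coe, and_imp]

theorem subset_closure (A : DiffLieOmega k lam ar L) (s : Set L) : s ⊆ A.closure s :=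
  fun _ hx => (A.mem_closure s _).2 fun _ _ hS => hS hx

theorem isClosed_closure (A : DiffLieOmega k lam ar L) (s : Set L) :
    A.IsClosed (A.closure s) :=
  ⟨fun _ hx => (A.mem_closure s _).2 fun S hS hs => hS.1 _ ((A.mem_closure s _).1 hx S hS hs),
    fun ω _ ha => (A.mem_closure s _).2 fun S hS hs =>
      hS.2 ω _ fun j => (A.mem_closure s _).1 (ha j) S hS hs⟩

/-- The structure induced on a closed Lie subalgebra. -/
def restrict (A : DiffLieOmega k lam ar L) (S : LieSubalgebra k L) (hS : A.IsClosed S) :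
    DiffLieOmega k lam ar S where
  D :=
    { toFun := fun x => ⟨A.D x, hS.1 x x.2⟩
      map_add' := fun x y => Subtype.ext (map_add A.D (x : L) (y : L))
      map_smul' := fun c x => Subtype.ext (map_smul A.D c (x : L)) }
  D_lie x y := Subtype.ext (A.D_lie x y)
  op ω :=
    { toFun := fun a => ⟨A.op ω (fun j => (a j : L)), hS.2 ω _ fun j => (a j).2⟩
      map_update_add' := fun a i x y => Subtype.ext <| by
        have h : ∀ z : S, (fun j => (Function.update a i z j : L)) =
            Function.update (fun j => (a j : L)) i (z : L) := fun z => by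
          funext j; by_cases hj : j = i
          · subst hj; simp
          · simp [hj]
        change A.op ω (fun j => (Function.update a i (x + y) j : L)) =
          A.op ω (fun j => (Function.update a i x j : L)) +
            A.op ω (fun j => (Function.update a i y j : L))
        rw [h, h, h]; exact (A.op ω).map_update_add _ i (x : L) (y : L)
      map_update_smul' := fun a i c x => Subtype.ext <| by
        have h : ∀ z : S, (fun j => (Function.update a i z j : L)) =
            Function.update (fun j => (a j : L)) i (z : L) := fun z => by
          funext j; by_cases hj : j = i
          · subst hj; simp
          · simp [hj]
        change A.op ω (fun j => (Function.update a i (c • x) j : L)) =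
          c • A.op ω (fun j => (Function.update a i x j : L))
        rw [h, h]; exact (A.op ω).map_update_smul _ i c (x : L) }

section Eval

variable {X : Type u}

mutual
/-- The value of a bracketed prime word in `A`, for given values `f` of the generators. -/
def evalLetter (A : DiffLieOmega k lam ar L) (f : X → L) : NLetter X ar → L
  | .gen x => f x
  | .op ω a => A.op ω (fun j => evalWord A f (a j))
  | .diff p => A.D (evalLetter A f p)
/-- The value of a differential nonassociative word in `A`: products are read as Lie brackets. -/
def evalWord (A : DiffLieOmega k lam ar L) (f : X → L) : FreeMagma (NLetter X ar) → L
  | .of p => evalLetter A f p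
  | .mul v w => ⁅evalWord A f v, evalWord A f w⁆
end

end Eval

end DiffLieOmega

/-! ### The free differential associative algebra with operators -/

section DA

variable (k : Type w) [Field k] (lam : k) (X : Type u) {Ω : Type v} (ar : Ω → ℕ)

/-- `DA⟨Ω; X⟩`: the semigroup algebra of the semigroup `⟨D, Ω; X⟩`. -/
abbrev DA : Type (max u v w) := MonoidAlgebra k (Word X ar)

variable {X ar}

/-- A word as an element of `DA⟨Ω; X⟩`. -/
noncomputable def ofWord (u : Word X ar) : DA k X ar := MonoidAlgebra.single u 1

/-- `D(u₁ ⋯ u_t)` for prime words `u₁, …, u_t`, by recursion on `t`: it is the prime word `D(u₁)`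
for `t = 1`, and `D(u₁) (u₂ ⋯ u_t) + u₁ D(u₂ ⋯ u_t) + lam D(u₁) D(u₂ ⋯ u_t)` for `t > 1`. -/
noncomputable def diffList : Letter X ar → List (Letter X ar) → DA k X ar
  | p, [] => ofWord k (.of (.diff p))
  | p, q :: t =>
      ofWord k (.of (.diff p)) * ofWord k ⟨q, t⟩ + ofWord k (.of p) * diffList q t +
        lam • (ofWord k (.of (.diff p)) * diffList q t)

/-- `D(u)` for a word `u`. -/
noncomputable def diffWord (u : Word X ar) : DA k X ar := diffList k lam u.head u.tail

/-- The linear extension of `D` to `DA⟨Ω; X⟩`. -/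
noncomputable def diffDA : DA k X ar →ₗ[k] DA k X ar :=
  (MonoidAlgebra.basis (Word X ar) k).constr k (diffWord k lam)

variable (X ar) in
/-- The multilinear extension of `(u₁, …, u_m) ↦ ω(u₁, …, u_m)` to `DA⟨Ω; X⟩`. -/
noncomputable def opDA (ω : Ω) : MultilinearMap k (fun _ : Fin (ar ω) => DA k X ar) (DA k X ar) :=
  ((Basis.piTensorProduct fun _ : Fin (ar ω) => MonoidAlgebra.basis (Word X ar) k).constr k
    fun a => ofWord k (.of (.op ω a))).compMultilinearMap (PiTensorProduct.tprod k)

theorem diffDA_ofWord (u : Word X ar) : diffDA k lam (ofWord k u) = diffWord k lam u := by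
  have h := (MonoidAlgebra.basis (Word X ar) k).constr_basis k (diffWord k lam) u
  rwa [MonoidAlgebra.basis_apply] at h

theorem opDA_ofWord (ω : Ω) (a : Fin (ar ω) → Word X ar) :
    opDA k X ar ω (fun j => ofWord k (a j)) = ofWord k (.of (.op ω a)) := by
  have h := (Basis.piTensorProduct
    fun _ : Fin (ar ω) => MonoidAlgebra.basis (Word X ar) k).constr_basis k
    (fun a => ofWord k (.of (.op ω a))) a
  rw [Basis.piTensorProduct_apply] at h
  simp only [MonoidAlgebra.basis_apply] at h
  exact h

theorem ofWord_mul (u v : Word X ar) : ofWord k (u * v) = ofWord k u * ofWord k v := by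
  simp [ofWord, MonoidAlgebra.single_mul_single]

theorem diffWord_mul (u v : Word X ar) :
    diffWord k lam (u * v) = diffWord k lam u * ofWord k v + ofWord k u * diffWord k lam v +
      lam • (diffWord k lam u * diffWord k lam v) := by
  obtain ⟨p, t⟩ := u
  obtain ⟨q, s⟩ := v
  induction t generalizing p with
  | nil => rfl
  | cons r t ih =>
    have h1 : diffWord k lam ((⟨p, r :: t⟩ : Word X ar) * ⟨q, s⟩) =
        ofWord k (.of (.diff p)) * ofWord k ((⟨r, t⟩ : Word X ar) * ⟨q, s⟩) +
        ofWord k (.of p) * diffWord k lam ((⟨r, t⟩ : Word X ar) * ⟨q, s⟩) +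
        lam • (ofWord k (.of (.diff p)) *
          diffWord k lam ((⟨r, t⟩ : Word X ar) * ⟨q, s⟩)) := rfl
    have h2 : diffWord k lam (⟨p, r :: t⟩ : Word X ar) =
        ofWord k (.of (.diff p)) * ofWord k (⟨r, t⟩ : Word X ar) +
        ofWord k (.of p) * diffWord k lam (⟨r, t⟩ : Word X ar) +
        lam • (ofWord k (.of (.diff p)) * diffWord k lam (⟨r, t⟩ : Word X ar)) := rfl
    have h3 : ofWord k (⟨p, r :: t⟩ : Word X ar) =
        ofWord k (.of p) * ofWord k (⟨r, t⟩ : Word X ar) := ofWord_mul k (.of p) ⟨r, t⟩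
    rw [h1, h2, h3, ih, ofWord_mul]
    simp only [add_mul, mul_add, smul_mul_assoc, mul_smul_comm, smul_add, mul_assoc]
    abel

theorem diffDA_mul (f g : DA k X ar) :
    diffDA k lam (f * g) = diffDA k lam f * g + f * diffDA k lam g +
      lam • (diffDA k lam f * diffDA k lam g) := by
  have key : ∀ (u : Word X ar) (c : k), MonoidAlgebra.single u c = c • ofWord k u := fun u c => by
    simp [ofWord, MonoidAlgebra.smul_single]
  induction f using MonoidAlgebra.induction_linear with
  | zero => simp
  | add f₁ f₂ h₁ h₂ => simp only [add_mul, map_add, h₁, h₂, smul_add]; abel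
  | single u c =>
    induction g using MonoidAlgebra.induction_linear with
    | zero => simp
    | add g₁ g₂ h₁ h₂ => simp only [mul_add, map_add, h₁, h₂, smul_add]; abel
    | single v d =>
      rw [key, key]
      simp only [smul_mul_assoc, mul_smul_comm, map_smul, ← ofWord_mul, diffDA_ofWord,
        diffWord_mul, smul_add, smul_comm lam]

variable (X ar) in
/-- `DA⟨Ω; X⟩` as a `lam`-differential associative algebra with operators. -/
noncomputable def assocDA : DiffAssocOmega k lam ar (DA k X ar) where
  D := diffDA k lam
  D_mul := diffDA_mul k lam
  op := opDA k X ar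

noncomputable instance : LieRing (DA k X ar) := commLieRing _

noncomputable instance : LieAlgebra k (DA k X ar) := commLieAlgebra k _

variable (X ar) in
/-- `DA⟨Ω; X⟩` as a `lam`-differential Lie algebra with operators, under the commutator. -/
noncomputable def lieDA : DiffLieOmega k lam ar (DA k X ar) := (assocDA k lam X ar).toLie

/-- The generator `x` as an element of `DA⟨Ω; X⟩`. -/
noncomputable def genDA (x : X) : DA k X ar := ofWord k (.of (.gen x))

variable (X ar) in
/-- `DLie(Ω; X)`: the `lam`-differential Lie subalgebra with operators of `DA⟨Ω; X⟩` generated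
by `X`. -/
noncomputable def DLie : LieSubalgebra k (DA k X ar) :=
  (lieDA k lam X ar).closure (Set.range (genDA k))

variable (X ar) in
/-- The `lam`-differential Lie algebra with operators `DLie(Ω; X)`. -/
noncomputable def lieDLie : DiffLieOmega k lam ar (DLie k lam X ar) :=
  (lieDA k lam X ar).restrict (DLie k lam X ar) ((lieDA k lam X ar).isClosed_closure _)

variable (ar) in
/-- The generator `x` as an element of `DLie(Ω; X)`. -/
noncomputable def genDLie (x : X) : DLie k lam X ar :=
  ⟨genDA k x, (lieDA k lam X ar).subset_closure _ ⟨x, rfl⟩⟩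

end DA

end DiffLie

/-!
# Lyndon–Shirshov words are a basis of the free `lam`-differential Lie algebra with operators

The theorem follows from two facts about the values of the Lyndon–Shirshov words `NLSW(D, Ω; X)`.

*They are linearly independent in `DA⟨Ω; X⟩`.* In the Deg-lex order, the leading word of such a
value is the word with all brackets erased (`hasLead_evalWord`). For a product
`(v)(w)` this is so because `vw` is a Lyndon–Shirshov word and hence greater than `wv`; for an operation and for powers of `D`
it is so because these are monotone on prime words. Different Lyndon–Shirshov words have different
underlying words (`eraseWord_injOn`): the right factor of such a word is its longest proper suffix
that is a Lyndon word (`length_le_of_isNLSW_mul`), so the bracketing can be recovered.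

*Their span is closed under all operations, in every `lam`-differential Lie algebra with operators
and for all values of the generators.* For the bracket this is the rewriting of a product of two
Lyndon–Shirshov words by the Jacobi identity (`bracketEval_lie_mem_of_lt`). The operations of `Ω`
and `D` map Lyndon–Shirshov words, respectively letters, to letters, and
`D ⁅x, y⁆` is an expression in brackets. So the span is the subalgebra generated by the generators (`closure_toSubmodule`).

Together these give the basis of `DLie(Ω; X)`. For freeness, let `M` be another algebra with chosen
values of the generators, and consider the span of the Lyndon–Shirshov words in `DLie(Ω; X) × M`. It
is the graph of the linear map that takes each Lyndon–Shirshov word to its value in `M`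
(`prod_mem_nlswSpan_iff`). As the graph is closed under all operations, this map is a homomorphism.
-/

namespace DiffLie

/-! ### Lyndon words over a linearly ordered alphabet -/

section Lyndon

variable {α : Type u}

theorem append_lt_append_of_not_prefix [LinearOrder α] {u v : List α} (h : u < v)
    (hp : ¬ u <+: v) (x y : List α) : u ++ x < v ++ y := by
  replace h : List.Lex (· < ·) u v := h
  induction h with
  | nil => exact absurd List.nil_prefix hp
  | @cons a l₁ l₂ _ ih =>
    exact List.Lex.cons (ih fun h' => hp (by simpa using h'))
  | rel hab => exact List.Lex.rel hab

theorem append_lt_append_of_length_le [LinearOrder α] {u v : List α} (h : u < v)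
    (hl : v.length ≤ u.length) (x y : List α) : u ++ x < v ++ y :=
  append_lt_append_of_not_prefix h
    (fun hp => h.ne (hp.eq_of_length (le_antisymm hp.length_le hl))) x y

theorem lt_append_self [LinearOrder α] (u : List α) {v : List α} (hv : v ≠ []) : u < u ++ v := by
  have h : List.Lex (· < ·) [] v := by
    cases v with
    | nil => exact absurd rfl hv
    | cons a l => exact List.Lex.nil
  have := List.Lex.append_left (· < ·) h u
  rwa [List.append_nil] at this

theorem append_lt_append_left_iff [LinearOrder α] (s : List α) {u v : List α} :
    s ++ u < s ++ v ↔ u < v := by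
  induction s with
  | nil => rfl
  | cons a s ih =>
    exact (List.lex_cons_iff (r := ((· < ·) : α → α → Prop))).trans ih

/-- The order of the Lyndon–Shirshov convention, in which the empty word is the greatest, is the
opposite of the usual lexicographic order over the opposite alphabet. -/
theorem lexLT_gt_iff [LinearOrder α] (u v : List α) :
    LexLT (fun a b : α => b < a) u v ↔ v < u := by
  induction u generalizing v with
  | nil => simp [LexLT]
  | cons a u ih =>
    cases v with
    | nil => simp [LexLT]
    | cons b v =>
      rw [LexLT, ih, List.cons_lt_cons_iff, eq_comm]

/-- Lyndon words in the usual convention: nonempty words that are smaller than all of their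
proper nonempty suffixes. -/
def IsLyndon [LinearOrder α] (w : List α) : Prop :=
  w ≠ [] ∧ ∀ u v : List α, u ≠ [] → v ≠ [] → w = u ++ v → w < v

/-- Being smaller than all proper suffixes is the same as being smaller than all nontrivial
rotations. -/
theorem isALSW_gt_iff [LinearOrder α] (w : List α) :
    IsALSW (fun a b : α => b < a) w ↔ IsLyndon w := by
  refine and_congr_right fun _ => ⟨fun h u v hu hv hw => ?_, fun h u v hu hv hw => ?_⟩
  · simp only [lexLT_gt_iff] at h
    have h1 := h u v hu hv hw
    subst hw
    by_contra hle
    rcases (not_lt.1 hle).lt_or_eq with hlt | heq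
    · by_cases hp : v <+: u ++ v
      · -- A border `v` would give `u' < u` and `u < u'` for the complementary factor `u'`.
        obtain ⟨u', hu'⟩ := hp
        have hlen : u'.length = u.length := by
          have := congrArg List.length hu'
          simp at this; omega
        have h2 := h v u' hv
          (by rintro rfl; exact hu (List.eq_nil_of_length_eq_zero hlen.symm)) hu'.symm
        rw [← hu', append_lt_append_left_iff] at h1
        rw [hu'] at h2
        exact lt_asymm h2 (append_lt_append_of_length_le h1 hlen.ge v v)
      · have h2 := append_lt_append_of_not_prefix hlt hp u []
        rw [List.append_nil] at h2
        exact lt_asymm h1 h2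
    · have := congrArg List.length heq
      simp at this; exact hu this
  · rw [lexLT_gt_iff]
    have h1 := h u v hu hv hw
    subst hw
    have := append_lt_append_of_length_le h1 (by simp) [] u
    rwa [List.append_nil] at this

theorem IsLyndon.append [LinearOrder α] {u v : List α} (hu : IsLyndon u) (hv : IsLyndon v)
    (h : u < v) : IsLyndon (u ++ v) := by
  have huv : u ++ v < v := by
    by_cases hp : u <+: v
    · obtain ⟨v', rfl⟩ := hp
      rw [append_lt_append_left_iff]
      refine hv.2 u v' hu.1 ?_ rfl
      rintro rfl
      simp at h
    · have := append_lt_append_of_not_prefix h hp v []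
      rwa [List.append_nil] at this
  refine ⟨by simp [hu.1], fun a b ha hb hab => ?_⟩
  rcases List.append_eq_append_iff.1 hab with ⟨c, rfl, hc⟩ | ⟨c, hc, rfl⟩
  · rcases eq_or_ne c [] with rfl | hc0
    · simp only [List.nil_append] at hc
      rwa [← hc]
    · exact huv.trans (hv.2 c b hc0 hb hc)
  · rcases eq_or_ne c [] with rfl | hc0
    · simpa using huv
    · refine append_lt_append_of_length_le (hu.2 a c ha hc0 hc) ?_ v v
      simp [hc]

theorem exists_isLyndon_suffix_le [LinearOrder α] (t : List α) (ht : t ≠ []) :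
    ∃ a q : List α, t = a ++ q ∧ IsLyndon q ∧ q ≤ t := by
  induction hn : t.length using Nat.strong_induction_on generalizing t with
  | _ n ih =>
    by_cases hL : IsLyndon t
    · exact ⟨[], t, rfl, hL, le_rfl⟩
    · simp only [IsLyndon, not_and, not_forall, not_lt] at hL
      obtain ⟨u, v, hu, hv, htv, hle⟩ := hL ht
      have := List.length_pos_iff.2 hu
      obtain ⟨a, q, rfl, hq, hqv⟩ := ih v.length (by rw [← hn, htv]; simp; omega) v hv rfl
      exact ⟨u ++ a, q, by rw [htv, List.append_assoc], hq, hqv.trans hle⟩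

/-! ### Nonassociative Lyndon–Shirshov words -/

theorem flat_ne_nil (v : FreeMagma α) : flat v ≠ [] := by
  induction v with
  | ih1 a => exact List.cons_ne_nil _ _
  | ih2 v w hv _ => exact List.append_ne_nil_of_left_ne_nil hv _

theorem flat_mul (v w : FreeMagma α) : flat (v * w) = flat v ++ flat w := rfl

theorem flat_of (a : α) : flat (FreeMagma.of a) = [a] := rfl

theorem isALSW_singleton (r : α → α → Prop) (a : α) : IsALSW r [a] := by
  refine ⟨List.cons_ne_nil _ _, fun u v hu hv h => ?_⟩
  have := congrArg List.length h
  have := List.length_pos_iff.2 hu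
  have := List.length_pos_iff.2 hv
  simp at *; omega

theorem IsNLSW.of (r : α → α → Prop) (a : α) : IsNLSW r (FreeMagma.of a) :=
  isALSW_singleton r a

theorem IsNLSW.isALSW {r : α → α → Prop} {v : FreeMagma α} (h : IsNLSW r v) :
    IsALSW r (flat v) := by
  cases v with
  | of a => exact h
  | mul v w => exact h.1

theorem lexLT_congr {r r' : α → α → Prop} {u v : List α}
    (h : ∀ a ∈ u, ∀ b ∈ v, (r a b ↔ r' a b)) : LexLT r u v ↔ LexLT r' u v := by
  induction u generalizing v with
  | nil => simp [LexLT]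
  | cons a u ih =>
    cases v with
    | nil => simp [LexLT]
    | cons b v =>
      rw [LexLT, LexLT, h a (by simp) b (by simp),
        ih fun a ha b hb => h a (by simp [ha]) b (by simp [hb])]

theorem isALSW_congr {r r' : α → α → Prop} {w : List α}
    (h : ∀ a ∈ w, ∀ b ∈ w, (r a b ↔ r' a b)) : IsALSW r w ↔ IsALSW r' w := by
  refine and_congr_right fun _ => forall₂_congr fun u v => forall₃_congr fun _ _ hw => ?_
  subst hw
  exact lexLT_congr fun a ha b hb => h a (by simpa [or_comm] using ha) b hb

theorem isNLSW_congr {r r' : α → α → Prop} {v : FreeMagma α}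
    (h : ∀ a ∈ flat v, ∀ b ∈ flat v, (r a b ↔ r' a b)) : IsNLSW r v ↔ IsNLSW r' v := by
  induction v with
  | ih1 a => exact isALSW_congr h
  | ih2 v w hv hw =>
    simp only [flat_mul, List.mem_append] at h
    refine and_congr (isALSW_congr (by simpa using h)) (and_congr
      (hv fun a ha b hb => h a (.inl ha) b (.inl hb)) (and_congr
      (hw fun a ha b hb => h a (.inr ha) b (.inr hb))
      (forall₃_congr fun v₁ v₂ hv' => or_congr_right (lexLT_congr fun a ha b hb =>
        h a (.inl ?_) b (.inr hb)))))
    rw [hv']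
    exact List.mem_append_right _ ha

/-- `IsNLSW` for the opposite of a linear order, in terms of Lyndon words: the right factor `w` of
`v * w` is at most the right factor of `v`. -/
theorem isNLSW_mul_iff [LinearOrder α] (v w : FreeMagma α) :
    IsNLSW (fun a b : α => b < a) (v * w) ↔ IsLyndon (flat v ++ flat w) ∧
      IsNLSW (fun a b : α => b < a) v ∧ IsNLSW (fun a b : α => b < a) w ∧
      ∀ v₁ v₂ : FreeMagma α, v = v₁ * v₂ → flat w ≤ flat v₂ := by
  rw [← isALSW_gt_iff]
  refine and_congr_right fun _ => and_congr_right fun _ => and_congr_right fun _ =>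
    forall₃_congr fun v₁ v₂ _ => ?_
  rw [lexLT_gt_iff, le_iff_eq_or_lt, eq_comm]

theorem IsNLSW.isLyndon [LinearOrder α] {v : FreeMagma α}
    (h : IsNLSW (fun a b : α => b < a) v) : IsLyndon (flat v) :=
  (isALSW_gt_iff _).1 h.isALSW

/-- The right factor of a nonassociative Lyndon–Shirshov word is the longest proper suffix that is
a Lyndon word. -/
theorem length_le_of_isNLSW_mul [LinearOrder α] {v w : FreeMagma α}
    (h : IsNLSW (fun a b : α => b < a) (v * w)) {p s : List α} (hp : p ≠ []) (hs : IsLyndon s)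
    (heq : flat v ++ flat w = p ++ s) : s.length ≤ (flat w).length := by
  induction v generalizing w p s with
  | ih1 a =>
    have := congrArg List.length heq
    have := List.length_pos_iff.2 hp
    simp [flat] at *; omega
  | ih2 v₁ v₂ ih₁ ih₂ =>
    by_contra! hlt
    obtain ⟨-, hv, -, hvw⟩ := (isNLSW_mul_iff _ _).1 h
    have hw := hvw v₁ v₂ rfl
    rcases List.append_eq_append_iff.1 heq with ⟨c, hc, hc'⟩ | ⟨t, hc, hc'⟩
    · have := congrArg List.length hc'
      simp at this; omega
    · have ht : t ≠ [] := by rintro rfl; simp [hc'] at hlt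
      -- The least suffix `q` of `t` satisfies `q ≤ t < s < w ≤ v₂ ≤ q`.
      obtain ⟨a, q, rfl, hq, hqt⟩ := exists_isLyndon_suffix_le t ht
      rw [flat_mul, ← List.append_assoc] at hc
      have hlen := ih₁ hv (p := p ++ a) (by simp [hp]) hq hc
      have hv₂ : IsLyndon (flat v₂) := ((isNLSW_mul_iff _ _).1 hv).2.2.1.isLyndon
      have hle : flat v₂ ≤ q := by
        rcases List.append_eq_append_iff.1 hc with ⟨c, hc1, hc2⟩ | ⟨c, hc1, hc2⟩
        · rcases eq_or_ne c [] with rfl | hc0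
          · simp only [List.nil_append] at hc2
            rw [hc2]
          · exact (hv₂.2 c q hc0 hq.1 hc2).le
        · have : c = [] := by
            have := congrArg List.length hc2
            simp at this
            exact List.eq_nil_of_length_eq_zero (by omega)
          subst this
          rw [hc2]; rfl
      have h1 : a ++ q < s := hc' ▸ lt_append_self _ (flat_ne_nil w)
      have h2 : s < flat w := hs.2 _ _ ht (flat_ne_nil w) hc'
      exact absurd (hqt.trans_lt (h1.trans h2)) (hw.trans hle).not_gt

/-- A word has at most one Lyndon–Shirshov bracketing. -/
theorem IsNLSW.eq_of_flat_eq [LinearOrder α] {v v' : FreeMagma α}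
    (hv : IsNLSW (fun a b : α => b < a) v) (hv' : IsNLSW (fun a b : α => b < a) v')
    (h : flat v = flat v') : v = v' := by
  induction v generalizing v' with
  | ih1 a =>
    induction v' with
    | ih1 b => exact congrArg FreeMagma.of (List.cons.inj h).1
    | ih2 v₁ v₂ _ _ =>
      have := congrArg List.length h
      have := List.length_pos_iff.2 (flat_ne_nil v₁)
      have := List.length_pos_iff.2 (flat_ne_nil v₂)
      simp [flat_mul, flat_of] at *; omega
  | ih2 v₁ v₂ ih₁ ih₂ =>
    induction v' with
    | ih1 b =>
      have := congrArg List.length h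
      have := List.length_pos_iff.2 (flat_ne_nil v₁)
      have := List.length_pos_iff.2 (flat_ne_nil v₂)
      simp [flat_mul, flat_of] at *; omega
    | ih2 w₁ w₂ _ _ =>
      obtain ⟨-, hv₁, hv₂, -⟩ := (isNLSW_mul_iff _ _).1 hv
      obtain ⟨-, hw₁, hw₂, -⟩ := (isNLSW_mul_iff _ _).1 hv'
      rw [flat_mul, flat_mul] at h
      have h1 := length_le_of_isNLSW_mul hv (flat_ne_nil w₁) hw₂.isLyndon h
      have h2 := length_le_of_isNLSW_mul hv' (flat_ne_nil v₁) hv₂.isLyndon h.symm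
      obtain ⟨h3, h4⟩ := List.append_inj' h (le_antisymm h2 h1)
      rw [ih₁ hv₁ hw₁ h3, ih₂ hv₂ hw₂ h4]

end Lyndon

/-! ### Lie brackets of Lyndon–Shirshov words -/

section Bracket

variable {α : Type u} {k : Type*} [Field k] {L : Type*} [LieRing L] [LieAlgebra k L]

/-- The value of a nonassociative word in a Lie algebra, for given values of the letters. -/
def bracketEval (g : α → L) : FreeMagma α → L
  | .of a => g a
  | .mul v w => ⁅bracketEval g v, bracketEval g w⁆

/-- Nonassociative Lyndon–Shirshov words of length `n` with letters in `A` whose underlying word is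
smaller than `m`. -/
def boundedNLSW [LinearOrder α] (A : Set α) (n : ℕ) (m : List α) : Set (FreeMagma α) :=
  {t | t ∈ NLSWOn (fun a b : α => b < a) A ∧ (flat t).length = n ∧ flat t < m}

variable (k) in
/-- The bracket of Lyndon–Shirshov words `u < v` is a combination of Lyndon–Shirshov words `t < v`
of the same length. If `u = u₁ u₂` with `u₂ < v`, then
`[[u₁, u₂], v] = [[u₁, v], u₂] + [u₁, [u₂, v]]`, where the inner brackets are shorter, and after
their expansion both factors of the outer brackets are smaller than `v`. -/
theorem bracketEval_lie_mem_of_lt [LinearOrder α] (g : α → L) {A : Set α} (hA : A.Finite) (n : ℕ) :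
    ∀ u ∈ NLSWOn (fun a b : α => b < a) A, ∀ v ∈ NLSWOn (fun a b : α => b < a) A,
      (flat u).length + (flat v).length = n → flat u < flat v →
      ⁅bracketEval g u, bracketEval g v⁆ ∈
        Submodule.span k (bracketEval g '' boundedNLSW A n (flat v)) := by
  induction n using Nat.strong_induction_on with
  | _ n ihn =>
  have hfin : {l : List α | l.length ≤ n ∧ ∀ a ∈ l, a ∈ A}.Finite := by
    have := hA.to_subtype
    refine ((List.finite_length_le A n).image (List.map Subtype.val)).subset ?_
    rintro l ⟨hl, hlA⟩
    lift l to List A using hlA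
    exact ⟨l, by simpa using hl, rfl⟩
  suffices H : ∀ m ∈ {l : List α | l.length ≤ n ∧ ∀ a ∈ l, a ∈ A},
      ∀ u ∈ NLSWOn (fun a b : α => b < a) A, ∀ v ∈ NLSWOn (fun a b : α => b < a) A,
      (flat u).length + (flat v).length = n → flat u < flat v → flat v = m →
      ⁅bracketEval g u, bracketEval g v⁆ ∈
        Submodule.span k (bracketEval g '' boundedNLSW A n m) by
    intro u hu v hv hn huv
    exact H _ ⟨by omega, hv.1⟩ u hu v hv hn huv rfl
  intro m hm
  refine (hfin.wellFoundedOn (r := (· < ·))).induction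
    (P := fun m => ∀ u ∈ NLSWOn (fun a b : α => b < a) A, ∀ v ∈ NLSWOn (fun a b : α => b < a) A,
      (flat u).length + (flat v).length = n → flat u < flat v → flat v = m →
      ⁅bracketEval g u, bracketEval g v⁆ ∈
        Submodule.span k (bracketEval g '' boundedNLSW A n m)) hm fun m _ ihm => ?_
  have mono : ∀ {m' : List α}, m' ≤ m →
      Submodule.span k (bracketEval g '' boundedNLSW A n m') ≤
        Submodule.span k (bracketEval g '' boundedNLSW A n m) := fun h =>
    Submodule.span_mono (Set.image_mono fun t ht => ⟨ht.1, ht.2.1, ht.2.2.trans_le h⟩)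
  have symm : ∀ u ∈ NLSWOn (fun a b : α => b < a) A, ∀ v ∈ NLSWOn (fun a b : α => b < a) A,
      (flat u).length + (flat v).length = n → flat u < m → flat v < m →
      ⁅bracketEval g u, bracketEval g v⁆ ∈
        Submodule.span k (bracketEval g '' boundedNLSW A n m) := by
    intro u hu v hv hn hum hvm
    rcases lt_trichotomy (flat u) (flat v) with h | h | h
    · exact mono hvm.le (ihm _ ⟨by omega, hv.1⟩ hvm u hu v hv hn h rfl)
    · rw [hu.2.eq_of_flat_eq hv.2 h, lie_self]
      exact Submodule.zero_mem _
    · rw [← lie_skew]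
      exact Submodule.neg_mem _
        (mono hum.le (ihm _ ⟨by omega, hu.1⟩ hum v hv u hu (by omega) h rfl))
  have right : ∀ (n' : ℕ) (x : L), x ∈ Submodule.span k (bracketEval g '' boundedNLSW A n' m) →
      ∀ u ∈ NLSWOn (fun a b : α => b < a) A, n' + (flat u).length = n → flat u < m →
      ⁅x, bracketEval g u⁆ ∈ Submodule.span k (bracketEval g '' boundedNLSW A n m) := by
    intro n' x hx u hu hn hum
    induction hx using Submodule.span_induction with
    | mem x hx =>
      obtain ⟨t, ht, rfl⟩ := hx
      exact symm t ht.1 u hu (ht.2.1 ▸ hn) ht.2.2 hum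
    | zero => rw [zero_lie]; exact Submodule.zero_mem _
    | add x y _ _ hx hy => rw [add_lie]; exact Submodule.add_mem _ hx hy
    | smul c x _ hx => rw [smul_lie]; exact Submodule.smul_mem _ c hx
  rintro u ⟨huA, hu⟩ v ⟨hvA, hv⟩ hn huv rfl
  -- If `u * v` is itself a Lyndon–Shirshov word, there is nothing to expand.
  have done : (∀ u₁ u₂ : FreeMagma α, u = u₁ * u₂ → flat v ≤ flat u₂) →
      ⁅bracketEval g u, bracketEval g v⁆ ∈
        Submodule.span k (bracketEval g '' boundedNLSW A n (flat v)) := by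
    intro h
    have hL := hu.isLyndon.append hv.isLyndon huv
    refine Submodule.subset_span ⟨u * v, ⟨⟨?_, (isNLSW_mul_iff _ _).2 ⟨hL, hu, hv, h⟩⟩, ?_, ?_⟩,
      rfl⟩
    · intro a ha
      rcases List.mem_append.1 ha with ha | ha
      exacts [huA a ha, hvA a ha]
    · rw [flat_mul, List.length_append, hn]
    · exact hL.2 _ _ (flat_ne_nil u) (flat_ne_nil v) rfl
  induction u with
  | ih1 a =>
    refine done fun u₁ u₂ h => ?_
    cases h
  | ih2 u₁ u₂ _ _ =>
    rcases le_or_gt (flat v) (flat u₂) with hle | hlt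
    · refine done fun w₁ w₂ h => ?_
      cases h
      exact hle
    · obtain ⟨-, hu₁, hu₂, -⟩ := (isNLSW_mul_iff _ _).1 hu
      rw [flat_mul] at huA huv hn
      have huA₁ : ∀ a ∈ flat u₁, a ∈ A := fun a ha => huA a (List.mem_append_left _ ha)
      have huA₂ : ∀ a ∈ flat u₂, a ∈ A := fun a ha => huA a (List.mem_append_right _ ha)
      rw [List.length_append] at hn
      have hl₁ := List.length_pos_iff.2 (flat_ne_nil u₁)
      have hl₂ := List.length_pos_iff.2 (flat_ne_nil u₂)
      have hlt₁ : flat u₁ < flat v := (lt_append_self _ (flat_ne_nil u₂)).trans huv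
      have e₁ := ihn _ (by omega) u₁ ⟨huA₁, hu₁⟩ v ⟨hvA, hv⟩ rfl hlt₁
      have e₂ := ihn _ (by omega) u₂ ⟨huA₂, hu₂⟩ v ⟨hvA, hv⟩ rfl hlt
      have f₁ := right _ _ e₁ u₂ ⟨huA₂, hu₂⟩ (by omega) hlt
      have f₂ := right _ _ e₂ u₁ ⟨huA₁, hu₁⟩ (by omega) hlt₁
      have key : ⁅bracketEval g (u₁ * u₂), bracketEval g v⁆ =
          ⁅⁅bracketEval g u₁, bracketEval g v⁆, bracketEval g u₂⁆ -
            ⁅⁅bracketEval g u₂, bracketEval g v⁆, bracketEval g u₁⁆ := by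
        change ⁅⁅bracketEval g u₁, bracketEval g u₂⁆, bracketEval g v⁆ = _
        rw [lie_lie, ← lie_skew _ ⁅bracketEval g u₁, bracketEval g v⁆,
          ← lie_skew _ ⁅bracketEval g u₂, bracketEval g v⁆]
        abel
      rw [key]
      exact Submodule.sub_mem _ f₁ f₂

variable (k) in
/-- The values of the Lyndon–Shirshov words span a subspace that is closed under the bracket. -/
theorem bracketEval_lie_mem_span [LinearOrder α] (g : α → L) (Z : Set α) {x y : L}
    (hx : x ∈ Submodule.span k (bracketEval g '' NLSWOn (fun a b : α => b < a) Z))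
    (hy : y ∈ Submodule.span k (bracketEval g '' NLSWOn (fun a b : α => b < a) Z)) :
    ⁅x, y⁆ ∈ Submodule.span k (bracketEval g '' NLSWOn (fun a b : α => b < a) Z) := by
  have base : ∀ u ∈ NLSWOn (fun a b : α => b < a) Z, ∀ v ∈ NLSWOn (fun a b : α => b < a) Z,
      flat u < flat v → ⁅bracketEval g u, bracketEval g v⁆ ∈
        Submodule.span k (bracketEval g '' NLSWOn (fun a b : α => b < a) Z) := by
    intro u hu v hv huv
    have hu' : u ∈ NLSWOn (fun a b : α => b < a) {a | a ∈ flat u ++ flat v} :=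
      ⟨fun a ha => List.mem_append_left _ ha, hu.2⟩
    have hv' : v ∈ NLSWOn (fun a b : α => b < a) {a | a ∈ flat u ++ flat v} :=
      ⟨fun a ha => List.mem_append_right _ ha, hv.2⟩
    have := bracketEval_lie_mem_of_lt k g (List.finite_toSet _) _ u hu' v hv' rfl huv
    refine Submodule.span_mono (Set.image_mono ?_) this
    refine fun t ht => ⟨fun a ha => ?_, ht.1.2⟩
    rcases List.mem_append.1 (ht.1.1 a ha) with h | h
    exacts [hu.1 a h, hv.1 a h]
  induction hx, hy using Submodule.span_induction₂ with
  | mem_mem x y hx hy =>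
    obtain ⟨u, hu, rfl⟩ := hx
    obtain ⟨v, hv, rfl⟩ := hy
    rcases lt_trichotomy (flat u) (flat v) with h | h | h
    · exact base u hu v hv h
    · rw [hu.2.eq_of_flat_eq hv.2 h, lie_self]
      exact Submodule.zero_mem _
    · rw [← lie_skew]
      exact Submodule.neg_mem _ (base v hv u hu h)
  | zero_left y hy => rw [zero_lie]; exact Submodule.zero_mem _
  | zero_right x hx => rw [lie_zero]; exact Submodule.zero_mem _
  | add_left x y z _ _ _ h₁ h₂ => rw [add_lie]; exact Submodule.add_mem _ h₁ h₂
  | add_right x y z _ _ _ h₁ h₂ => rw [lie_add]; exact Submodule.add_mem _ h₁ h₂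
  | smul_left c x y _ _ h => rw [smul_lie]; exact Submodule.smul_mem _ c h
  | smul_right c x y _ _ h => rw [lie_smul]; exact Submodule.smul_mem _ c h

end Bracket

/-! ### Structural induction on prime words -/

section Induction

variable {X : Type u} {Ω : Type v} {ar : Ω → ℕ}

theorem Letter.structural_induction {P : Letter X ar → Prop} (gen : ∀ x, P (.gen x))
    (op : ∀ ω a, (∀ j, ∀ p ∈ letters (a j), P p) → P (.op ω a))
    (diff : ∀ p, P p → P (.diff p)) (p : Letter X ar) : P p :=
  Letter.rec (motive_1 := P) (motive_2 := fun u => ∀ p ∈ letters u, P p)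
    (motive_3 := fun l => ∀ p ∈ l, P p) gen op diff
    (fun _ _ hp ht => List.forall_mem_cons.2 ⟨hp, ht⟩) (fun _ h => by cases h)
    (fun _ _ hp ht => List.forall_mem_cons.2 ⟨hp, ht⟩) p

theorem NLetter.structural_induction {P : NLetter X ar → Prop} (gen : ∀ x, P (.gen x))
    (op : ∀ ω a, (∀ j, ∀ p ∈ flat (a j), P p) → P (.op ω a))
    (diff : ∀ p, P p → P (.diff p)) (p : NLetter X ar) : P p :=
  NLetter.rec (motive_1 := P) (motive_2 := fun v => ∀ p ∈ flat v, P p) gen op diff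
    (fun _ hp _ hq => List.mem_singleton.1 hq ▸ hp)
    (fun _ _ hv hw p hp => (List.mem_append.1 hp).elim (hv p) (hw p)) p

theorem list_eq_of_map_eq {α : Type u} {β : Type v} {f : α → β} {l l' : List α}
    (h : ∀ a ∈ l, ∀ b ∈ l', f a = f b → a = b) (heq : l.map f = l'.map f) : l = l' := by
  induction l generalizing l' with
  | nil => exact (List.map_eq_nil_iff.1 heq.symm).symm
  | cons a l ih =>
    cases l' with
    | nil => cases heq
    | cons b l' =>
      obtain ⟨h₁, h₂⟩ := List.cons.inj heq
      rw [h a List.mem_cons_self b List.mem_cons_self h₁,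
        ih (fun a ha b hb => h a (List.mem_cons_of_mem _ ha) b (List.mem_cons_of_mem _ hb)) h₂]

theorem letters_injective {α : Type u} : Function.Injective (letters (α := α)) := by
  rintro ⟨p, t⟩ ⟨q, s⟩ h
  obtain ⟨rfl, rfl⟩ := List.cons.inj h
  rfl

theorem letters_mul {α : Type u} (u v : FreeSemigroup α) :
    letters (u * v) = letters u ++ letters v := rfl

theorem letters_of {α : Type u} (p : α) : letters (FreeSemigroup.of p) = [p] := rfl

theorem letters_eraseWord (v : NWord X ar) :
    letters (eraseWord v) = (flat v).map eraseLetter := by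
  induction v with
  | of p => rfl
  | mul v w hv hw =>
    rw [flat, List.map_append, ← hv, ← hw]
    rfl

theorem degList_eq_sum (l : List (Letter X ar)) : degList l = (l.map degLetter).sum := by
  induction l with
  | nil => rfl
  | cons p l ih => rw [degList, ih, List.map_cons, List.sum_cons]

theorem degWord_eq_sum (u : Word X ar) : degWord u = ((letters u).map degLetter).sum := by
  obtain ⟨p, t⟩ := u
  rw [degWord, degList_eq_sum, letters, List.map_cons, List.sum_cons]

theorem degWord_mul (u v : Word X ar) : degWord (u * v) = degWord u + degWord v := by
  simp only [degWord_eq_sum, letters_mul, List.map_append, List.sum_append]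

theorem degWord_of (p : Letter X ar) : degWord (FreeSemigroup.of p) = degLetter p := by
  simp [degWord_eq_sum, letters_of]

theorem degLetter_pos (p : Letter X ar) : 0 < degLetter p := by
  cases p with
  | gen x => exact Nat.one_pos
  | op ω a => exact Nat.add_pos_left Nat.one_pos _
  | diff p => exact Nat.add_pos_left Nat.one_pos _

theorem degWord_pos (u : Word X ar) : 0 < degWord u := by
  obtain ⟨p, t⟩ := u
  exact Nat.add_pos_left (degLetter_pos p) _

theorem one_lt_degLetter_op (har : ∀ ω, 1 ≤ ar ω) (ω : Ω) (a : Fin (ar ω) → Word X ar) :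
    1 < degLetter (.op ω a) := by
  have := Finset.single_le_sum (f := fun j => degWord (a j)) (fun _ _ => Nat.zero_le _)
    (Finset.mem_univ ⟨0, har ω⟩)
  have := degWord_pos (a ⟨0, har ω⟩)
  rw [degLetter]
  omega

theorem one_lt_degLetter_diff (p : Letter X ar) : 1 < degLetter (.diff p) := by
  have := degLetter_pos p
  rw [degLetter]
  omega

end Induction

/-! ### The Deg-lex order is a linear order -/

section Order

theorem lex_of_append_cons {α : Type u} {r : α → α → Prop} {l l' s t t' : List α} {p q : α}
    (hl : l = s ++ p :: t) (hl' : l' = s ++ q :: t') (h : r p q) : List.Lex r l l' := by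
  subst hl hl'
  exact List.Lex.append_left r (.rel h) s

theorem exists_append_cons_of_lex {α : Type u} {r : α → α → Prop} {l l' : List α}
    (h : List.Lex r l l') (hlen : l.length = l'.length) :
    ∃ (s t t' : List α) (p q : α), l = s ++ p :: t ∧ l' = s ++ q :: t' ∧ r p q := by
  induction h with
  | nil => simp at hlen
  | @cons a l l' _ ih =>
    obtain ⟨s, t, t', p, q, rfl, rfl, h⟩ := ih (by simpa using hlen)
    exact ⟨a :: s, t, t', p, q, rfl, rfl, h⟩
  | @rel a l b l' h => exact ⟨[], l, l', a, b, rfl, rfl, h⟩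

theorem lex_irrefl_of_forall {α : Type u} {r : α → α → Prop} {l : List α}
    (h : ∀ a ∈ l, ¬ r a a) : ¬ List.Lex r l l := by
  induction l with
  | nil => intro h'; cases h'
  | cons a l ih =>
    intro h'
    cases h' with
    | cons h' => exact ih (fun a ha => h a (List.mem_cons_of_mem _ ha)) h'
    | rel h' => exact h a List.mem_cons_self h'

theorem lex_trans_of_forall {α : Type u} {r : α → α → Prop} {l₁ l₂ l₃ : List α}
    (h : ∀ a ∈ l₁, ∀ b c, r a b → r b c → r a c) (h₁ : List.Lex r l₁ l₂)
    (h₂ : List.Lex r l₂ l₃) : List.Lex r l₁ l₃ := by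
  induction h₁ generalizing l₃ with
  | nil => cases h₂ <;> exact .nil
  | cons h₁ ih =>
    cases h₂ with
    | cons h₂ => exact .cons (ih (fun a ha => h a (List.mem_cons_of_mem _ ha)) h₂)
    | rel h₂ => exact .rel h₂
  | rel h₁ =>
    cases h₂ with
    | cons h₂ => exact .rel h₁
    | rel h₂ => exact .rel (h _ List.mem_cons_self _ _ h₁ h₂)

theorem lex_trichotomy_of_forall {α : Type u} {r : α → α → Prop} {l l' : List α}
    (h : ∀ a ∈ l, ∀ b, r a b ∨ a = b ∨ r b a) :
    List.Lex r l l' ∨ l = l' ∨ List.Lex r l' l := by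
  induction l generalizing l' with
  | nil => cases l' with
    | nil => exact .inr (.inl rfl)
    | cons b l' => exact .inl .nil
  | cons a l ih => cases l' with
    | nil => exact .inr (.inr .nil)
    | cons b l' =>
      rcases h a List.mem_cons_self b with hab | rfl | hab
      · exact .inl (.rel hab)
      · rcases ih (fun a ha => h a (List.mem_cons_of_mem _ ha)) (l' := l') with h | rfl | h
        exacts [.inl (.cons h), .inr (.inl rfl), .inr (.inr (.cons h))]
      · exact .inr (.inr (.rel hab))

variable {X : Type u} {Ω : Type v} {ar : Ω → ℕ}

theorem wordLT_iff [LT X] [LT Ω] {u v : Word X ar} : WordLT u v ↔ degWord u < degWord v ∨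
    degWord u = degWord v ∧ ((letters u).length < (letters v).length ∨
      (letters u).length = (letters v).length ∧ List.Lex LetterLT (letters u) (letters v)) := by
  constructor
  · rintro (h | ⟨hd, h⟩ | ⟨hd, hl, s, t, t', p, q, hu, hv, h⟩)
    exacts [.inl h, .inr ⟨hd, .inl h⟩, .inr ⟨hd, .inr ⟨hl, lex_of_append_cons hu hv h⟩⟩]
  · rintro (h | ⟨hd, h | ⟨hl, h⟩⟩)
    · exact .deg h
    · exact .bre hd h
    · obtain ⟨s, t, t', p, q, hu, hv, h⟩ := exists_append_cons_of_lex h hl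
      exact .lex hd hl s t t' p q hu hv h

theorem WordLT.degWord_le [LT X] [LT Ω] {u v : Word X ar} (h : WordLT u v) :
    degWord u ≤ degWord v := by
  cases h <;> omega

theorem LetterLT.degLetter_le [LT X] [LT Ω] {p q : Letter X ar} (h : LetterLT p q) :
    degLetter p ≤ degLetter q := by
  induction p using Letter.structural_induction generalizing q with
  | gen x => cases h with
    | deg h => exact h.le
    | gen h => simp only [degLetter, le_refl]
  | op ω a _ => cases h with
    | deg h => exact h.le
    | op hd _ => exact hd.le
    | arg hd _ _ _ => exact hd.le
  | diff p ih => cases h with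
    | deg h => exact h.le
    | diff h => simpa only [degLetter, add_le_add_iff_left] using ih h
    | diff_op hd => exact hd.le

theorem wordLT_irrefl_of_forall [LT X] [LT Ω] {u : Word X ar}
    (h : ∀ p ∈ letters u, ¬ LetterLT p p) : ¬ WordLT u u := by
  rw [wordLT_iff]
  simpa using lex_irrefl_of_forall h

theorem wordLT_trans_of_forall [LT X] [LT Ω] {u v w : Word X ar}
    (h : ∀ p ∈ letters u, ∀ q r, LetterLT p q → LetterLT q r → LetterLT p r)
    (h₁ : WordLT u v) (h₂ : WordLT v w) : WordLT u w := by
  rw [wordLT_iff] at *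
  rcases h₁ with h₁ | ⟨hd₁, h₁ | ⟨hl₁, h₁⟩⟩ <;> rcases h₂ with h₂ | ⟨hd₂, h₂ | ⟨hl₂, h₂⟩⟩
  on_goal 9 => exact .inr ⟨by omega, .inr ⟨by omega, lex_trans_of_forall h h₁ h₂⟩⟩
  all_goals omega

theorem wordLT_trichotomy_of_forall [LT X] [LT Ω] {u : Word X ar}
    (h : ∀ p ∈ letters u, ∀ q, LetterLT p q ∨ p = q ∨ LetterLT q p) (v : Word X ar) :
    WordLT u v ∨ u = v ∨ WordLT v u := by
  rw [wordLT_iff, wordLT_iff]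
  rcases lt_trichotomy (degWord u) (degWord v) with hd | hd | hd
  · exact .inl (.inl hd)
  · rcases lt_trichotomy (letters u).length (letters v).length with hl | hl | hl
    · exact .inl (.inr ⟨hd, .inl hl⟩)
    · rcases lex_trichotomy_of_forall h (l' := letters v) with h | h | h
      · exact .inl (.inr ⟨hd, .inr ⟨hl, h⟩⟩)
      · exact .inr (.inl (letters_injective h))
      · exact .inr (.inr (.inr ⟨hd.symm, .inr ⟨hl.symm, h⟩⟩))
    · exact .inr (.inr (.inr ⟨hd.symm, .inl hl⟩))
  · exact .inr (.inr (.inl hd))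

theorem letterLT_irrefl [LinearOrder X] [LinearOrder Ω] (p : Letter X ar) : ¬ LetterLT p p := by
  induction p using Letter.structural_induction with
  | gen x =>
    rintro (h | h)
    exacts [lt_irrefl _ h, lt_irrefl _ h]
  | op ω a ih =>
    intro h
    cases h with
    | deg h => exact lt_irrefl _ h
    | op _ h => exact lt_irrefl _ h
    | arg _ j _ h => exact wordLT_irrefl_of_forall (ih j) h
  | diff p ih =>
    intro h
    cases h with
    | deg h => exact lt_irrefl _ h
    | diff h => exact ih h

theorem letterLT_trans [LinearOrder X] [LinearOrder Ω] {p q r : Letter X ar}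
    (h₁ : LetterLT p q) (h₂ : LetterLT q r) : LetterLT p r := by
  induction p using Letter.structural_induction generalizing q r with
  | gen x =>
    rcases (h₁.degLetter_le.trans h₂.degLetter_le).lt_or_eq with hd | hd
    · exact .deg hd
    · have := h₁.degLetter_le
      have := h₂.degLetter_le
      cases h₁ with
      | deg h => omega
      | gen h₁ => cases h₂ with
        | deg h => omega
        | gen h₂ => exact .gen (h₁.trans h₂)
  | op ω a ih =>
    rcases (h₁.degLetter_le.trans h₂.degLetter_le).lt_or_eq with hd | hd
    · exact .deg hd
    · have := h₁.degLetter_le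
      have := h₂.degLetter_le
      cases h₁ with
      | deg h => omega
      | op _ h₁ => cases h₂ with
        | deg h => omega
        | op _ h₂ => exact .op hd (h₁.trans h₂)
        | arg _ j _ _ => exact .op hd h₁
      | arg _ i heq₁ h₁ => cases h₂ with
        | deg h => omega
        | op _ h₂ => exact .op hd h₂
        | arg _ j heq₂ h₂ =>
          rcases lt_trichotomy i j with hij | rfl | hij
          · exact .arg hd i (fun l hl => (heq₁ l hl).trans (heq₂ l (hl.trans hij)))
              (heq₂ i hij ▸ h₁)
          · exact .arg hd i (fun l hl => (heq₁ l hl).trans (heq₂ l hl))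
              (wordLT_trans_of_forall (fun p hp q r => ih i p hp) h₁ h₂)
          · exact .arg hd j (fun l hl => (heq₁ l (hl.trans hij)).trans (heq₂ l hl))
              ((heq₁ j hij).symm ▸ h₂)
  | diff p ih =>
    rcases (h₁.degLetter_le.trans h₂.degLetter_le).lt_or_eq with hd | hd
    · exact .deg hd
    · have := h₁.degLetter_le
      have := h₂.degLetter_le
      cases h₁ with
      | deg h => omega
      | diff h₁ => cases h₂ with
        | deg h => omega
        | diff h₂ => exact .diff (ih h₁ h₂)
        | diff_op _ => exact .diff_op hd
      | diff_op _ => cases h₂ with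
        | deg h => omega
        | op _ _ => exact .diff_op hd
        | arg _ _ _ _ => exact .diff_op hd

theorem exists_first_ne {m : ℕ} {β : Type u} {a b : Fin m → β} (h : a ≠ b) :
    ∃ j, a j ≠ b j ∧ ∀ i < j, a i = b i := by
  obtain ⟨j, hj, hmin⟩ := WellFounded.has_min (wellFounded_lt (α := Fin m)) {j | a j ≠ b j}
    (Function.ne_iff.1 h)
  exact ⟨j, hj, fun i hi => by_contra fun h => hmin i h hi⟩

/-- Prime words of equal degree are comparable because a generator has degree `1`, while any other
prime word has a larger degree, all operations having an argument. -/
theorem letterLT_trichotomy [LinearOrder X] [LinearOrder Ω] (har : ∀ ω, 1 ≤ ar ω)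
    (p q : Letter X ar) :
    LetterLT p q ∨ p = q ∨ LetterLT q p := by
  induction p using Letter.structural_induction generalizing q with
  | gen x =>
    rcases lt_trichotomy (degLetter (.gen x : Letter X ar)) (degLetter q) with hd | hd | hd
    · exact .inl (.deg hd)
    · cases q with
      | gen y =>
        rcases lt_trichotomy x y with h | rfl | h
        exacts [.inl (.gen h), .inr (.inl rfl), .inr (.inr (.gen h))]
      | op ω b => exact absurd hd (one_lt_degLetter_op har ω b).ne
      | diff q => exact absurd hd (one_lt_degLetter_diff q).ne
    · exact .inr (.inr (.deg hd))
  | op ω a ih =>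
    rcases lt_trichotomy (degLetter (.op ω a)) (degLetter q) with hd | hd | hd
    · exact .inl (.deg hd)
    · cases q with
      | gen y => exact absurd hd (one_lt_degLetter_op har ω a).ne'
      | op θ b =>
        rcases lt_trichotomy ω θ with h | rfl | h
        · exact .inl (.op hd h)
        · rcases eq_or_ne a b with rfl | hab
          · exact .inr (.inl rfl)
          · obtain ⟨j, hj, heq⟩ := exists_first_ne hab
            rcases wordLT_trichotomy_of_forall (ih j) (b j) with h | h | h
            · exact .inl (.arg hd j heq h)
            · exact absurd h hj
            · exact .inr (.inr (.arg hd.symm j (fun i hi => (heq i hi).symm) h))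
        · exact .inr (.inr (.op hd.symm h))
      | diff q => exact .inr (.inr (.diff_op hd.symm))
    · exact .inr (.inr (.deg hd))
  | diff p ih =>
    rcases lt_trichotomy (degLetter (.diff p)) (degLetter q) with hd | hd | hd
    · exact .inl (.deg hd)
    · cases q with
      | gen y => exact absurd hd (one_lt_degLetter_diff p).ne'
      | op θ b => exact .inl (.diff_op hd)
      | diff q =>
        rcases ih q with h | rfl | h
        exacts [.inl (.diff h), .inr (.inl rfl), .inr (.inr (.diff h))]
    · exact .inr (.inr (.deg hd))

theorem wordLT_irrefl [LinearOrder X] [LinearOrder Ω] (u : Word X ar) : ¬ WordLT u u :=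
  wordLT_irrefl_of_forall fun p _ => letterLT_irrefl p

theorem wordLT_trans [LinearOrder X] [LinearOrder Ω] {u v w : Word X ar}
    (h₁ : WordLT u v) (h₂ : WordLT v w) : WordLT u w :=
  wordLT_trans_of_forall (fun _ _ _ _ => letterLT_trans) h₁ h₂

/-! ### Compatibility of the order with products and operations -/

theorem wordLT_of_iff [LinearOrder X] [LinearOrder Ω] {p q : Letter X ar} :
    WordLT (.of p) (.of q) ↔ LetterLT p q := by
  simp only [wordLT_iff, degWord_of, letters_of, List.length_singleton, lt_irrefl, false_or,
    true_and, List.lex_singleton_iff]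
  exact ⟨fun h => h.elim .deg And.right, fun h =>
    h.degLetter_le.lt_or_eq.imp_right fun h' => ⟨h', h⟩⟩

theorem WordLT.mul_left [LinearOrder X] [LinearOrder Ω] {u v : Word X ar} (w : Word X ar)
    (h : WordLT u v) : WordLT (w * u) (w * v) := by
  rw [wordLT_iff] at *
  simp only [degWord_mul, letters_mul, List.length_append, add_lt_add_iff_left,
    add_right_inj] at *
  exact h.imp_right (And.imp_right (Or.imp_right (And.imp_right fun h =>
    List.Lex.append_left _ h _)))

theorem WordLT.mul_right [LinearOrder X] [LinearOrder Ω] {u v : Word X ar} (w : Word X ar)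
    (h : WordLT u v) : WordLT (u * w) (v * w) := by
  rw [wordLT_iff] at *
  simp only [degWord_mul, letters_mul, List.length_append, add_lt_add_iff_right,
    add_left_inj] at *
  refine h.imp_right (And.imp_right (Or.imp_right fun h => ⟨h.1, ?_⟩))
  obtain ⟨s, t, t', p, q, hu, hv, h⟩ := exists_append_cons_of_lex h.2 h.1
  exact lex_of_append_cons (s := s) (t := t ++ letters w) (t' := t' ++ letters w)
    (by simp [hu]) (by simp [hv]) h

theorem letterLT_op [LinearOrder X] [LinearOrder Ω] {ω : Ω} {a b : Fin (ar ω) → Word X ar}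
    (h : ∀ j, a j = b j ∨ WordLT (a j) (b j)) (hne : a ≠ b) :
    LetterLT (.op ω a) (.op ω b) := by
  have hle : ∀ j ∈ Finset.univ, degWord (a j) ≤ degWord (b j) := fun j _ =>
    (h j).elim (fun h => (congrArg degWord h).le) WordLT.degWord_le
  rcases (Finset.sum_le_sum hle).lt_or_eq with hd | hd
  · exact .deg (by simpa only [degLetter, add_lt_add_iff_left] using hd)
  · obtain ⟨j, hj, heq⟩ := exists_first_ne hne
    exact .arg (by simp only [degLetter, hd]) j heq ((h j).resolve_left hj)

end Order

/-! ### The alphabet of the Lyndon–Shirshov words -/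

section Alphabet

variable {X : Type u} {Ω : Type v} {ar : Ω → ℕ} [LinearOrder X] [LinearOrder Ω]

variable (X ar) in
/-- The letters that occur in the words of `NLSW(D, Ω; X)`. -/
def nlswLetters : Set (NLetter X ar) := {p | FreeMagma.of p ∈ NLSW X ar}

variable (X ar) in
/-- The alphabet of `NLSW(D, Ω; X)_n`. -/
def stageLetters : ℕ → Set (NLetter X ar)
  | 0 => deltaGen X ar
  | n + 1 => deltaGen X ar ∪ deltaOp X ar (NLSWStage X ar n)

theorem nlswStage_eq (n : ℕ) :
    NLSWStage X ar n = NLSWOn (NLetterLT X ar) (stageLetters X ar n) := by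
  cases n <;> rfl

theorem nlswOn_mono {α : Type u} {r : α → α → Prop} {Z Z' : Set α} (h : Z ⊆ Z') :
    NLSWOn r Z ⊆ NLSWOn r Z' := fun _ hv => ⟨fun a ha => h (hv.1 a ha), hv.2⟩

theorem stageLetters_mono : Monotone (stageLetters X ar) := by
  refine monotone_nat_of_le_succ fun n => ?_
  induction n with
  | zero => exact Set.subset_union_left
  | succ n ih =>
    refine Set.union_subset_union_right _ ?_
    rintro p ⟨i, ω, a, ha, rfl⟩
    refine ⟨i, ω, a, fun j => ?_, rfl⟩
    have := ha j
    rw [nlswStage_eq] at this ⊢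
    exact nlswOn_mono ih this

theorem nlswStage_mono : Monotone (NLSWStage X ar) := fun m n h => by
  rw [nlswStage_eq, nlswStage_eq]
  exact nlswOn_mono (stageLetters_mono h)

theorem mem_nlswLetters {p : NLetter X ar} :
    p ∈ nlswLetters X ar ↔ ∃ n, p ∈ stageLetters X ar n := by
  simp only [nlswLetters, NLSW, Set.mem_ofPred_eq, Set.mem_iUnion, nlswStage_eq]
  exact exists_congr fun n => ⟨fun h => h.1 p (List.mem_singleton_self p),
    fun h => ⟨fun a ha => List.mem_singleton.1 ha ▸ h, IsNLSW.of _ p⟩⟩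

theorem exists_stage_of_forall {ι : Type*} [Finite ι] {Q : ℕ → ι → Prop}
    (hQ : ∀ j, Monotone fun n => Q n j) (h : ∀ j, ∃ n, Q n j) : ∃ n, ∀ j, Q n j := by
  choose n hn using h
  obtain ⟨N, hN⟩ := (Set.finite_range n).bddAbove
  exact ⟨N, fun j => hQ j (hN ⟨j, rfl⟩) (hn j)⟩

theorem nlsw_eq : NLSW X ar = NLSWOn (NLetterLT X ar) (nlswLetters X ar) := by
  ext v
  simp only [NLSW, Set.mem_iUnion, nlswStage_eq]
  constructor
  · rintro ⟨n, hv⟩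
    exact ⟨fun p hp => mem_nlswLetters.2 ⟨n, hv.1 p hp⟩, hv.2⟩
  · rintro ⟨hl, hv⟩
    have : Finite {p // p ∈ flat v} := (List.finite_toSet (flat v)).to_subtype
    obtain ⟨n, hn⟩ := exists_stage_of_forall (ι := {p // p ∈ flat v})
      (Q := fun n p => p.1 ∈ stageLetters X ar n) (fun p m n h hp => stageLetters_mono h hp)
      (fun p => mem_nlswLetters.1 (hl p.1 p.2))
    exact ⟨n, fun p hp => hn ⟨p, hp⟩, hv⟩

theorem gen_mem_nlswLetters (x : X) : NLetter.gen x ∈ nlswLetters X ar :=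
  mem_nlswLetters.2 ⟨0, 0, x, rfl⟩

theorem diff_mem_nlswLetters {p : NLetter X ar} :
    NLetter.diff p ∈ nlswLetters X ar ↔ p ∈ nlswLetters X ar := by
  have hg : NLetter.diff p ∈ deltaGen X ar ↔ p ∈ deltaGen X ar := by
    constructor
    · rintro ⟨_ | i, x, h⟩
      · cases h
      · rw [Function.iterate_succ_apply'] at h
        exact ⟨i, x, NLetter.diff.inj h⟩
    · rintro ⟨i, x, rfl⟩
      exact ⟨i + 1, x, (Function.iterate_succ_apply' _ _ _).symm⟩
  have ho : ∀ W, NLetter.diff p ∈ deltaOp X ar W ↔ p ∈ deltaOp X ar W := by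
    intro W
    constructor
    · rintro ⟨_ | i, ω, a, ha, h⟩
      · cases h
      · rw [Function.iterate_succ_apply'] at h
        exact ⟨i, ω, a, ha, NLetter.diff.inj h⟩
    · rintro ⟨i, ω, a, ha, rfl⟩
      exact ⟨i + 1, ω, a, ha, (Function.iterate_succ_apply' _ _ _).symm⟩
  simp only [mem_nlswLetters]
  refine exists_congr fun n => ?_
  cases n with
  | zero => exact hg
  | succ n => exact or_congr hg (ho _)

theorem op_mem_nlswLetters {ω : Ω} {a : Fin (ar ω) → NWord X ar} :
    NLetter.op ω a ∈ nlswLetters X ar ↔ ∀ j, a j ∈ NLSW X ar := by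
  have hg : NLetter.op ω a ∉ deltaGen X ar := by
    rintro ⟨_ | i, x, h⟩
    · cases h
    · rw [Function.iterate_succ_apply'] at h
      cases h
  rw [mem_nlswLetters]
  constructor
  · rintro ⟨_ | n, h⟩
    · exact absurd h hg
    · obtain ⟨_ | i, θ, b, hb, h⟩ := h.resolve_left hg
      · cases h
        exact fun j => Set.mem_iUnion.2 ⟨n, hb j⟩
      · rw [Function.iterate_succ_apply'] at h
        cases h
  · intro h
    obtain ⟨n, hn⟩ := exists_stage_of_forall (Q := fun n j => a j ∈ NLSWStage X ar n)
      (fun j m n h hj => nlswStage_mono h hj) (fun j => Set.mem_iUnion.1 (h j))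
    exact ⟨n + 1, .inr ⟨0, ω, a, hn, rfl⟩⟩

/-- Prime words can be compared, so the order on bracketed prime words has a linear refinement. It
is reversed here, as in `lexLT_gt_iff`. -/
theorem exists_linearOrder_nLetter (har : ∀ ω, 1 ≤ ar ω) :
    ∃ o : LinearOrder (NLetter X ar), ∀ p q, NLetterLT X ar p q → o.lt q p := by
  classical
  have : IsStrictTotalOrder (Letter X ar) LetterLT :=
    { trichotomous := fun p q h h' =>
        ((letterLT_trichotomy har p q).resolve_left h).resolve_right h'
      irrefl := letterLT_irrefl
      trans := fun _ _ _ => letterLT_trans }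
  let _ : LinearOrder (Letter X ar) := linearOrderOfSTO LetterLT
  let _ : LinearOrder (NLetter X ar) := linearOrderOfSTO WellOrderingRel
  refine ⟨LinearOrder.lift' (fun p : NLetter X ar => toLex (OrderDual.toDual (eraseLetter p), p))
    fun p q h => (Prod.ext_iff.1 h).2, fun p q h => ?_⟩
  change toLex (OrderDual.toDual (eraseLetter q), q) < toLex (OrderDual.toDual (eraseLetter p), p)
  exact Prod.Lex.toLex_lt_toLex.2 (.inl (OrderDual.toDual_lt_toDual.2 h))

/-- On letters that are distinguished by their underlying prime words, a linear refinement of the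
order is the order itself. -/
theorem nLetterLT_iff_of_injOn (har : ∀ ω, 1 ≤ ar ω) {o : LinearOrder (NLetter X ar)}
    (ho : ∀ p q, NLetterLT X ar p q → o.lt q p) {p q : NLetter X ar}
    (h : eraseLetter p = eraseLetter q → p = q) : NLetterLT X ar p q ↔ o.lt q p := by
  refine ⟨ho p q, fun hqp => ?_⟩
  rcases letterLT_trichotomy har (eraseLetter p) (eraseLetter q) with h' | h' | h'
  · exact h'
  · cases h h'
    exact absurd hqp (lt_irrefl _)
  · exact absurd hqp (ho q p h').asymm

/-- Erasing brackets is injective on the alphabet, by induction on the structure of letters: the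
arguments of an operation are Lyndon–Shirshov words, and these are determined by their letters. -/
theorem eraseLetter_injOn (har : ∀ ω, 1 ≤ ar ω) :
    Set.InjOn eraseLetter (nlswLetters X ar) := by
  intro p hp q hq h
  induction p using NLetter.structural_induction generalizing q with
  | gen x =>
    cases q with
    | gen y =>
      rw [eraseLetter, eraseLetter] at h
      exact congrArg _ (Letter.gen.inj h)
    | op ω b => simp [eraseLetter] at h
    | diff q => simp [eraseLetter] at h
  | op ω a ih =>
    cases q with
    | gen y => simp [eraseLetter] at h
    | op θ b =>
      rw [eraseLetter, eraseLetter] at h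
      obtain ⟨rfl, h⟩ := Letter.op.inj h
      rw [op_mem_nlswLetters, nlsw_eq] at hp hq
      congr 1
      funext j
      have hj := congrArg letters (congrFun (eq_of_heq h) j)
      rw [letters_eraseWord, letters_eraseWord] at hj
      have hflat := list_eq_of_map_eq
        (fun p hp' q hq' => ih j p hp' ((hp j).1 p hp') ((hq j).1 q hq')) hj
      obtain ⟨o, ho⟩ := exists_linearOrder_nLetter (X := X) har
      have hcongr : ∀ p ∈ flat (a j), ∀ q ∈ flat (a j), (NLetterLT X ar p q ↔ o.lt q p) :=
        fun p hp' q hq' => nLetterLT_iff_of_injOn har ho (ih j p hp' ((hp j).1 p hp')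
          ((hp j).1 q hq'))
      exact ((isNLSW_congr hcongr).1 (hp j).2).eq_of_flat_eq
        ((isNLSW_congr (hflat ▸ hcongr)).1 (hq j).2) hflat
    | diff q => simp [eraseLetter] at h
  | diff p ih =>
    cases q with
    | gen y => simp [eraseLetter] at h
    | op ω b => simp [eraseLetter] at h
    | diff q =>
      rw [eraseLetter, eraseLetter] at h
      exact congrArg _ (ih (diff_mem_nlswLetters.1 hp) (diff_mem_nlswLetters.1 hq)
        (Letter.diff.inj h))

/-- On the alphabet of the Lyndon–Shirshov words, the order is a linear order. -/
theorem exists_linearOrder_nlswLetters (har : ∀ ω, 1 ≤ ar ω) :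
    ∃ o : LinearOrder (NLetter X ar), NLSW X ar = NLSWOn (fun p q => o.lt q p)
      (nlswLetters X ar) := by
  obtain ⟨o, ho⟩ := exists_linearOrder_nLetter (X := X) har
  refine ⟨o, ?_⟩
  rw [nlsw_eq]
  ext v
  exact and_congr_right fun hv => isNLSW_congr fun p hp q hq =>
    nLetterLT_iff_of_injOn har ho (eraseLetter_injOn har (hv p hp) (hv q hq))

theorem eraseWord_injOn (har : ∀ ω, 1 ≤ ar ω) : Set.InjOn eraseWord (NLSW X ar) := by
  obtain ⟨o, ho⟩ := exists_linearOrder_nlswLetters (X := X) har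
  rw [ho]
  intro v hv w hw h
  have h' := congrArg letters h
  rw [letters_eraseWord, letters_eraseWord] at h'
  exact hv.2.eq_of_flat_eq hw.2 (list_eq_of_map_eq
    (fun p hp q hq => eraseLetter_injOn har (hv.1 p hp) (hw.1 q hq)) h')

end Alphabet

/-! ### Leading words -/

section Leading

theorem multilinear_map_mem_of_mem_span {k V W : Type*} [Field k] [AddCommGroup V] [Module k V]
    [AddCommGroup W] [Module k W] {m : ℕ} (f : MultilinearMap k (fun _ : Fin m => V) W)
    {S : Fin m → Set V} {N : Submodule k W} (h : ∀ a, (∀ j, a j ∈ S j) → f a ∈ N)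
    {x : Fin m → V} (hx : ∀ j, x j ∈ Submodule.span k (S j)) : f x ∈ N := by
  have hx' : ∀ j, ∃ c : S j →₀ k, Finsupp.linearCombination k (Subtype.val : S j → V) c = x j :=
    fun j => (Finsupp.mem_span_iff_linearCombination k (S j) (x j)).1 (hx j)
  choose c hc using hx'
  have h0 : (N.mkQ.compMultilinearMap f).compLinearMap
      (fun j => Finsupp.linearCombination k (Subtype.val : S j → V)) = 0 := by
    refine Module.Basis.ext_multilinear (fun j => Finsupp.basisSingleOne) fun v => ?_
    simpa [Submodule.Quotient.mk_eq_zero] using h (fun j => v j) fun j => (v j).2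
  have := congrArg (fun g => g c) h0
  simpa [hc, Submodule.Quotient.mk_eq_zero] using this

variable {k : Type w} [Field k] {lam : k} {X : Type u} [LinearOrder X] {Ω : Type v} [LinearOrder Ω]
  {ar : Ω → ℕ}

variable (k) in
/-- The combinations of words that are smaller than `u`. -/
noncomputable def below (u : Word X ar) : Submodule k (DA k X ar) :=
  Submodule.span k (ofWord k '' {w | WordLT w u})

/-- `f` has leading word `u`, with coefficient `1`. -/
def HasLead (f : DA k X ar) (u : Word X ar) : Prop := f - ofWord k u ∈ below k u

/-- `f` has leading word `p`, with coefficient `1`, and all of its words consist of a single prime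
word. Only for such elements is it plain what the operator `D` does to leading words. -/
def HasLetterLead (f : DA k X ar) (p : Letter X ar) : Prop :=
  f - ofWord k (.of p) ∈ Submodule.span k ((fun q => ofWord k (.of q)) '' {q | LetterLT q p})

theorem HasLetterLead.hasLead {f : DA k X ar} {p : Letter X ar} (h : HasLetterLead f p) :
    HasLead f (.of p) := by
  refine Submodule.span_mono ?_ h
  rintro _ ⟨q, hq, rfl⟩
  exact ⟨.of q, wordLT_of_iff.2 hq, rfl⟩

theorem below_mono {u v : Word X ar} (h : WordLT u v) : below k u ≤ below k v :=
  Submodule.span_mono (Set.image_mono fun _ hw => wordLT_trans hw h)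

theorem ofWord_mem_below {u v : Word X ar} (h : WordLT u v) : ofWord k u ∈ below k v :=
  Submodule.subset_span ⟨u, h, rfl⟩

theorem HasLead.mem_below {f : DA k X ar} {u v : Word X ar} (hf : HasLead f u) (h : WordLT u v) :
    f ∈ below k v := by
  rw [← sub_add_cancel f (ofWord k u)]
  exact Submodule.add_mem _ (below_mono h hf) (ofWord_mem_below h)

theorem ofWord_mul_mem_below (u : Word X ar) {v : Word X ar} {g : DA k X ar} (hg : g ∈ below k v) :
    ofWord k u * g ∈ below k (u * v) := by
  induction hg using Submodule.span_induction with
  | mem g hg =>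
    obtain ⟨w, hw, rfl⟩ := hg
    rw [← ofWord_mul]
    exact ofWord_mem_below (WordLT.mul_left u hw)
  | zero => rw [mul_zero]; exact Submodule.zero_mem _
  | add f g _ _ hf hg => rw [mul_add]; exact Submodule.add_mem _ hf hg
  | smul c f _ hf => rw [mul_smul_comm]; exact Submodule.smul_mem _ c hf

theorem mul_mem_below {u v : Word X ar} {f g : DA k X ar} (hf : f ∈ below k u)
    (hg : HasLead g v) : f * g ∈ below k (u * v) := by
  induction hf using Submodule.span_induction with
  | mem f hf =>
    obtain ⟨w, hw, rfl⟩ := hf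
    rw [← sub_add_cancel g (ofWord k v), mul_add, ← ofWord_mul]
    have h := WordLT.mul_right v hw
    exact Submodule.add_mem _ (below_mono h (ofWord_mul_mem_below w hg)) (ofWord_mem_below h)
  | zero => rw [zero_mul]; exact Submodule.zero_mem _
  | add f g _ _ hf hg => rw [add_mul]; exact Submodule.add_mem _ hf hg
  | smul c f _ hf => rw [smul_mul_assoc]; exact Submodule.smul_mem _ c hf

theorem HasLead.mul {u v : Word X ar} {f g : DA k X ar} (hf : HasLead f u) (hg : HasLead g v) :
    HasLead (f * g) (u * v) := by
  have h : f * g - ofWord k (u * v) =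
      (f - ofWord k u) * g + ofWord k u * (g - ofWord k v) := by
    rw [sub_mul, mul_sub, ofWord_mul]; abel
  rw [HasLead, h]
  exact Submodule.add_mem _ (mul_mem_below hf hg) (ofWord_mul_mem_below u hg)

theorem HasLead.lie {u v : Word X ar} {f g : DA k X ar} (hf : HasLead f u) (hg : HasLead g v)
    (h : WordLT (v * u) (u * v)) : HasLead ⁅f, g⁆ (u * v) := by
  have h' : ⁅f, g⁆ - ofWord k (u * v) = (f * g - ofWord k (u * v)) - g * f := by
    change (f * g - g * f) - _ = _
    abel
  rw [HasLead, h']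
  exact Submodule.sub_mem _ (hf.mul hg) ((hg.mul hf).mem_below h)

theorem HasLetterLead.diff {f : DA k X ar} {p : Letter X ar} (hf : HasLetterLead f p) :
    HasLetterLead (diffDA k lam f) (.diff p) := by
  have hD : ∀ q : Letter X ar, diffDA k lam (ofWord k (.of q)) = ofWord k (.of (.diff q)) :=
    fun q => diffDA_ofWord k lam _
  rw [HasLetterLead, ← hD, ← map_sub]
  have hle : Submodule.span k ((fun q => ofWord k (.of q)) '' {q | LetterLT q p}) ≤
      (Submodule.span k ((fun q => ofWord k (.of q)) '' {q | LetterLT q (.diff p)})).comap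
        (diffDA k lam) := by
    rw [Submodule.span_le]
    rintro _ ⟨q, hq, rfl⟩
    exact Submodule.subset_span ⟨.diff q, .diff hq, (hD q).symm⟩
  exact hle hf

/-- Expanding all arguments, `op ω f` is the leading term plus operations on arguments that are at
most the leading words and not all equal to them. -/
theorem HasLead.op {ω : Ω} {f : Fin (ar ω) → DA k X ar} {u : Fin (ar ω) → Word X ar}
    (hf : ∀ j, HasLead (f j) (u j)) : HasLetterLead (opDA k X ar ω f) (.op ω u) := by
  classical
  have hsum : opDA k X ar ω f =
      opDA k X ar ω ((fun j => ofWord k (u j)) + fun j => f j - ofWord k (u j)) :=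
    congrArg _ (funext fun j => by simp)
  rw [HasLetterLead, ← opDA_ofWord, hsum, MultilinearMap.map_add_univ,
    ← Finset.add_sum_erase _ _ (Finset.mem_univ Finset.univ),
    Finset.piecewise_univ, add_sub_cancel_left]
  refine Submodule.sum_mem _ fun s hs => ?_
  obtain ⟨j, hj⟩ : ∃ j, j ∉ s := by
    by_contra! h
    exact (Finset.mem_erase.1 hs).1 (Finset.eq_univ_iff_forall.2 h)
  refine multilinear_map_mem_of_mem_span (opDA k X ar ω)
    (S := fun i => ofWord k '' {w | if i ∈ s then w = u i else WordLT w (u i)}) ?_ fun i => ?_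
  · intro a ha
    choose b hb hab using ha
    obtain rfl : (fun i => ofWord k (b i)) = a := funext hab
    rw [opDA_ofWord]
    refine Submodule.subset_span ⟨.op ω b, letterLT_op (fun i => ?_) fun h => ?_, rfl⟩
    · have := hb i
      simp only [Set.mem_ofPred_eq] at this
      split_ifs at this
      exacts [.inl this, .inr this]
    · have := hb j
      simp only [Set.mem_ofPred_eq, if_neg hj, h] at this
      exact wordLT_irrefl _ this
  · by_cases hi : i ∈ s
    · rw [Finset.piecewise_eq_of_mem _ _ _ hi]
      exact Submodule.subset_span ⟨u i, by simp [hi], rfl⟩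
    · rw [Finset.piecewise_eq_of_notMem _ _ _ hi]
      have := hf i
      rw [HasLead, below] at this
      simpa only [if_neg hi] using this

theorem coeff_eq_zero_of_mem_below {f : DA k X ar} {u w : Word X ar} (hf : f ∈ below k u)
    (hw : ¬ WordLT w u) : f.coeff w = 0 := by
  classical
  induction hf using Submodule.span_induction with
  | mem f hf =>
    obtain ⟨v, hv, rfl⟩ := hf
    rw [ofWord, MonoidAlgebra.coeff_single, Finsupp.single_apply, if_neg]
    rintro rfl
    exact hw hv
  | zero => rfl
  | add f g _ _ hf hg => rw [MonoidAlgebra.coeff_add, Finsupp.add_apply, hf, hg, add_zero]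
  | smul c f _ hf => rw [MonoidAlgebra.coeff_smul, Finsupp.smul_apply, hf, smul_zero]

theorem HasLead.coeff_self {f : DA k X ar} {u : Word X ar} (hf : HasLead f u) :
    f.coeff u = 1 := by
  have := coeff_eq_zero_of_mem_below hf (wordLT_irrefl u)
  rw [MonoidAlgebra.coeff_sub, Finsupp.sub_apply, sub_eq_zero] at this
  simpa [ofWord] using this

theorem HasLead.coeff_eq_zero {f : DA k X ar} {u w : Word X ar} (hf : HasLead f u) (hne : w ≠ u)
    (hw : ¬ WordLT w u) : f.coeff w = 0 := by
  classical
  have := coeff_eq_zero_of_mem_below hf hw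
  rw [MonoidAlgebra.coeff_sub, Finsupp.sub_apply, sub_eq_zero] at this
  rw [this, ofWord, MonoidAlgebra.coeff_single, Finsupp.single_apply, if_neg hne.symm]

/-- Elements with pairwise different leading words are linearly independent. -/
theorem linearIndependent_of_hasLead {ι : Type*} {f : ι → DA k X ar} {u : ι → Word X ar}
    (hu : Function.Injective u) (hf : ∀ i, HasLead (f i) (u i)) : LinearIndependent k f := by
  classical
  let _ : PartialOrder (Word X ar) := @partialOrderOfSO _ WordLT
    { irrefl := wordLT_irrefl, trans := fun _ _ _ => wordLT_trans }
  rw [linearIndependent_iff']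
  intro s c hs
  by_contra! hne
  obtain ⟨i₀, hi₀, hc₀⟩ := hne
  obtain ⟨i, hi, hmax⟩ := (s.filter fun i => c i ≠ 0).exists_maximalFor u
    ⟨i₀, Finset.mem_filter.2 ⟨hi₀, hc₀⟩⟩
  obtain ⟨his, hci⟩ := Finset.mem_filter.1 hi
  have h := congrArg (fun g : DA k X ar => g.coeff (u i)) hs
  simp only [MonoidAlgebra.coeff_sum, Finsupp.finsetSum_apply, MonoidAlgebra.coeff_smul,
    Finsupp.smul_apply, smul_eq_mul, MonoidAlgebra.coeff_zero, Finsupp.zero_apply] at h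
  rw [Finset.sum_eq_single_of_mem i his, (hf i).coeff_self, mul_one] at h
  · exact hci h
  · intro j hj hji
    by_cases hcj : c j = 0
    · rw [hcj, zero_mul]
    · rw [(hf j).coeff_eq_zero (fun h => hji (hu h).symm), mul_zero]
      intro (hlt : u i < u j)
      exact hlt.not_ge (hmax (Finset.mem_filter.2 ⟨hj, hcj⟩) hlt.le)

theorem lex_map_of_lexLT {α β : Type*} {r : β → β → Prop} {f : α → β} {l l' : List α}
    (h : LexLT (fun a b => r (f a) (f b)) l l') (hlen : l.length = l'.length) :
    List.Lex r (l.map f) (l'.map f) := by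
  induction l generalizing l' with
  | nil => exact h.elim
  | cons a l ih =>
    cases l' with
    | nil => cases hlen
    | cons b l' =>
      rcases h with h | ⟨rfl, h⟩
      · exact .rel h
      · exact .cons (ih h (by simpa using hlen))

theorem wordLT_mul_comm_of_isALSW {v w : NWord X ar}
    (h : IsALSW (NLetterLT X ar) (flat v ++ flat w)) :
    WordLT (eraseWord w * eraseWord v) (eraseWord v * eraseWord w) := by
  have hlex := h.2 _ _ (flat_ne_nil v) (flat_ne_nil w) rfl
  refine wordLT_iff.2 (.inr ⟨?_, .inr ⟨?_, ?_⟩⟩)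
  · rw [degWord_mul, degWord_mul, add_comm]
  · simp only [letters_mul, List.length_append, add_comm]
  · simp only [letters_mul, letters_eraseWord, ← List.map_append]
    exact lex_map_of_lexLT hlex (by simp [add_comm])

theorem hasLead_evalWord_of_forall {v : NWord X ar} (hv : IsNLSW (NLetterLT X ar) v)
    (h : ∀ p ∈ flat v,
      HasLetterLead ((lieDA k lam X ar).evalLetter (genDA k) p) (eraseLetter p)) :
    HasLead ((lieDA k lam X ar).evalWord (genDA k) v) (eraseWord v) := by
  induction v with
  | of p => exact (h p (List.mem_singleton_self p)).hasLead
  | mul v w ihv ihw =>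
    exact (ihv hv.2.1 fun p hp => h p (List.mem_append_left _ hp)).lie
      (ihw hv.2.2.1 fun p hp => h p (List.mem_append_right _ hp))
      (wordLT_mul_comm_of_isALSW hv.1)

theorem hasLetterLead_evalLetter {p : NLetter X ar} (hp : p ∈ nlswLetters X ar) :
    HasLetterLead ((lieDA k lam X ar).evalLetter (genDA k) p) (eraseLetter p) := by
  induction p using NLetter.structural_induction with
  | gen x =>
    change ofWord k _ - ofWord k _ ∈ _
    rw [eraseLetter, sub_self]
    exact Submodule.zero_mem _
  | op ω a ih =>
    rw [op_mem_nlswLetters, nlsw_eq] at hp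
    rw [eraseLetter]
    exact HasLead.op fun j => hasLead_evalWord_of_forall (hp j).2 fun q hq =>
      ih j q hq ((hp j).1 q hq)
  | diff p ih =>
    rw [eraseLetter]
    exact (ih (diff_mem_nlswLetters.1 hp)).diff

/-- The leading word of a Lyndon–Shirshov word is the word without its brackets. -/
theorem hasLead_evalWord {v : NWord X ar} (hv : v ∈ NLSW X ar) :
    HasLead ((lieDA k lam X ar).evalWord (genDA k) v) (eraseWord v) := by
  rw [nlsw_eq] at hv
  exact hasLead_evalWord_of_forall hv.2 fun p hp => hasLetterLead_evalLetter (hv.1 p hp)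

variable (k lam) in
theorem linearIndependent_evalWord (har : ∀ ω, 1 ≤ ar ω) : LinearIndependent k
    fun v : NLSW X ar => (lieDA k lam X ar).evalWord (genDA k) (v : NWord X ar) :=
  linearIndependent_of_hasLead (u := fun v : NLSW X ar => eraseWord (v : NWord X ar))
    (fun v w h => Subtype.ext (eraseWord_injOn har v.2 w.2 h)) fun v => hasLead_evalWord v.2

end Leading

/-! ### Values of words -/

section Eval

variable {k : Type w} [Field k] {lam : k} {X : Type u} {Ω : Type v} {ar : Ω → ℕ}
  {L : Type*} [LieRing L] [LieAlgebra k L] {M : Type*} [LieRing M] [LieAlgebra k M]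

namespace DiffLieOmega

theorem evalWord_eq_bracketEval (A : DiffLieOmega k lam ar L) (f : X → L) (v : NWord X ar) :
    A.evalWord f v = bracketEval (A.evalLetter f) v := by
  induction v with
  | of p => rfl
  | mul v w hv hw => rw [evalWord, bracketEval, hv, hw]

mutual
theorem evalLetter_mem (A : DiffLieOmega k lam ar L) {f : X → L} {S : LieSubalgebra k L}
    (hS : A.IsClosed S) (hf : ∀ x, f x ∈ S) : ∀ p : NLetter X ar, A.evalLetter f p ∈ S
  | .gen x => hf x
  | .op ω a => hS.2 ω _ fun j => evalWord_mem A hS hf (a j)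
  | .diff p => hS.1 _ (evalLetter_mem A hS hf p)
theorem evalWord_mem (A : DiffLieOmega k lam ar L) {f : X → L} {S : LieSubalgebra k L}
    (hS : A.IsClosed S) (hf : ∀ x, f x ∈ S) : ∀ v : FreeMagma (NLetter X ar), A.evalWord f v ∈ S
  | .of p => evalLetter_mem A hS hf p
  | .mul v w => S.lie_mem (evalWord_mem A hS hf v) (evalWord_mem A hS hf w)
end

mutual
theorem IsHom.map_evalLetter {A : DiffLieOmega k lam ar L} {B : DiffLieOmega k lam ar M}
    {φ : L →ₗ⁅k⁆ M} (h : A.IsHom B φ) (f : X → L) :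
    ∀ p : NLetter X ar, φ (A.evalLetter f p) = B.evalLetter (fun x => φ (f x)) p
  | .gen _ => rfl
  | .op ω a => (h.2 ω _).trans (congrArg _ (funext fun j => IsHom.map_evalWord h f (a j)))
  | .diff p => (h.1 _).trans (congrArg _ (IsHom.map_evalLetter h f p))
theorem IsHom.map_evalWord {A : DiffLieOmega k lam ar L} {B : DiffLieOmega k lam ar M}
    {φ : L →ₗ⁅k⁆ M} (h : A.IsHom B φ) (f : X → L) :
    ∀ v : FreeMagma (NLetter X ar), φ (A.evalWord f v) = B.evalWord (fun x => φ (f x)) v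
  | .of p => IsHom.map_evalLetter h f p
  | .mul v w => (φ.map_lie _ _).trans
      (congrArg₂ _ (IsHom.map_evalWord h f v) (IsHom.map_evalWord h f w))
end

/-- The product of two `lam`-differential Lie algebras with operators. -/
def prod (A : DiffLieOmega k lam ar L) (B : DiffLieOmega k lam ar M) :
    DiffLieOmega k lam ar (L × M) where
  D := A.D.prodMap B.D
  D_lie x y := Prod.ext (A.D_lie x.1 y.1) (B.D_lie x.2 y.2)
  op ω := ((A.op ω).compLinearMap fun _ => LinearMap.fst k L M).prod
    ((B.op ω).compLinearMap fun _ => LinearMap.snd k L M)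

theorem isHom_fst (A : DiffLieOmega k lam ar L) (B : DiffLieOmega k lam ar M) :
    (A.prod B).IsHom A (LieHom.fst k L M) := ⟨fun _ => rfl, fun _ _ => rfl⟩

theorem isHom_snd (A : DiffLieOmega k lam ar L) (B : DiffLieOmega k lam ar M) :
    (A.prod B).IsHom B (LieHom.snd k L M) := ⟨fun _ => rfl, fun _ _ => rfl⟩

theorem evalWord_prod (A : DiffLieOmega k lam ar L) (B : DiffLieOmega k lam ar M) (f : X → L)
    (g : X → M) (v : NWord X ar) :
    (A.prod B).evalWord (fun x => (f x, g x)) v = (A.evalWord f v, B.evalWord g v) :=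
  Prod.ext ((isHom_fst A B).map_evalWord _ v) ((isHom_snd A B).map_evalWord _ v)

theorem isHom_incl (A : DiffLieOmega k lam ar L) (S : LieSubalgebra k L) (hS : A.IsClosed S) :
    (A.restrict S hS).IsHom A S.incl := ⟨fun _ => rfl, fun _ _ => rfl⟩

end DiffLieOmega

end Eval

/-! ### The span of the Lyndon–Shirshov words -/

section Span

variable {k : Type w} [Field k] {lam : k} {X : Type u} [LinearOrder X] {Ω : Type v} [LinearOrder Ω]
  {ar : Ω → ℕ} {L : Type*} [LieRing L] [LieAlgebra k L] {M : Type*} [LieRing M] [LieAlgebra k M]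

namespace DiffLieOmega

/-- The span of the values of the Lyndon–Shirshov words in a `lam`-differential Lie algebra with
operators. -/
def nlswSpan (A : DiffLieOmega k lam ar L) (f : X → L) : Submodule k L :=
  Submodule.span k (A.evalWord f '' NLSW X ar)

theorem evalWord_mem_nlswSpan (A : DiffLieOmega k lam ar L) (f : X → L) {v : NWord X ar}
    (hv : v ∈ NLSW X ar) : A.evalWord f v ∈ A.nlswSpan f :=
  Submodule.subset_span ⟨v, hv, rfl⟩

theorem lie_mem_nlswSpan (A : DiffLieOmega k lam ar L) (f : X → L) (har : ∀ ω, 1 ≤ ar ω) {x y : L}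
    (hx : x ∈ A.nlswSpan f) (hy : y ∈ A.nlswSpan f) : ⁅x, y⁆ ∈ A.nlswSpan f := by
  obtain ⟨o, ho⟩ := exists_linearOrder_nlswLetters (X := X) har
  have heq : A.evalWord f = bracketEval (A.evalLetter f) :=
    funext (A.evalWord_eq_bracketEval f)
  rw [nlswSpan, heq, ho] at hx hy ⊢
  exact bracketEval_lie_mem_span k _ _ hx hy

theorem op_mem_nlswSpan (A : DiffLieOmega k lam ar L) (f : X → L) (ω : Ω) {x : Fin (ar ω) → L}
    (hx : ∀ j, x j ∈ A.nlswSpan f) : A.op ω x ∈ A.nlswSpan f := by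
  refine multilinear_map_mem_of_mem_span (A.op ω) (fun a ha => ?_) hx
  choose v hv hva using ha
  obtain rfl : (fun j => A.evalWord f (v j)) = a := funext hva
  exact A.evalWord_mem_nlswSpan f (v := .of (.op ω v)) (op_mem_nlswLetters.2 hv)

/-- By induction on the number of letters: `D` maps the alphabet to itself, and `D ⁅x, y⁆` is made
of brackets of `x`, `y`, `D x`, `D y`. -/
theorem D_mem_nlswSpan (A : DiffLieOmega k lam ar L) (f : X → L) (har : ∀ ω, 1 ≤ ar ω) {x : L}
    (hx : x ∈ A.nlswSpan f) : A.D x ∈ A.nlswSpan f := by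
  have key : ∀ v ∈ NLSW X ar, A.D (A.evalWord f v) ∈ A.nlswSpan f := by
    intro v hv
    rw [nlsw_eq] at hv
    induction v with
    | of p =>
      exact A.evalWord_mem_nlswSpan f (v := .of (.diff p))
        (diff_mem_nlswLetters.2 (hv.1 p (List.mem_singleton_self p)))
    | mul v w ihv ihw =>
      have hv' : v ∈ NLSWOn (NLetterLT X ar) (nlswLetters X ar) :=
        ⟨fun p hp => hv.1 p (List.mem_append_left _ hp), hv.2.2.1⟩
      have hw' : w ∈ NLSWOn (NLetterLT X ar) (nlswLetters X ar) :=
        ⟨fun p hp => hv.1 p (List.mem_append_right _ hp), hv.2.2.2.1⟩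
      have hev : A.evalWord f v ∈ A.nlswSpan f := A.evalWord_mem_nlswSpan f (by rwa [nlsw_eq])
      have hew : A.evalWord f w ∈ A.nlswSpan f := A.evalWord_mem_nlswSpan f (by rwa [nlsw_eq])
      rw [evalWord, A.D_lie]
      exact Submodule.add_mem _ (Submodule.add_mem _
        (A.lie_mem_nlswSpan f har (ihv hv') hew) (A.lie_mem_nlswSpan f har hev (ihw hw')))
        (Submodule.smul_mem _ _ (A.lie_mem_nlswSpan f har (ihv hv') (ihw hw')))
  have hle : A.nlswSpan f ≤ (A.nlswSpan f).comap A.D := by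
    refine Submodule.span_le.2 ?_
    rintro _ ⟨v, hv, rfl⟩
    exact key v hv
  exact hle hx

theorem closure_toSubmodule (A : DiffLieOmega k lam ar L) (f : X → L) (har : ∀ ω, 1 ≤ ar ω) :
    (A.closure (Set.range f)).toSubmodule = A.nlswSpan f := by
  refine le_antisymm (fun x hx => ?_) (Submodule.span_le.2 ?_)
  · let S : LieSubalgebra k L :=
      { A.nlswSpan f with lie_mem' := fun hx hy => A.lie_mem_nlswSpan f har hx hy }
    refine (A.mem_closure _ x).1 hx S ⟨fun x hx => A.D_mem_nlswSpan f har hx,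
      fun ω a ha => A.op_mem_nlswSpan f ω ha⟩ ?_
    rintro _ ⟨x, rfl⟩
    exact A.evalWord_mem_nlswSpan f (v := .of (.gen x)) (gen_mem_nlswLetters x)
  · rintro _ ⟨v, -, rfl⟩
    exact A.evalWord_mem (A.isClosed_closure _)
      (fun x => A.subset_closure _ (Set.mem_range_self x)) v

end DiffLieOmega

end Span

/-! ### Freeness -/

section Free

variable {k : Type w} [Field k] {lam : k} {X : Type u} [LinearOrder X] {Ω : Type v} [LinearOrder Ω]
  {ar : Ω → ℕ} {L : Type*} [LieRing L] [LieAlgebra k L] {M : Type*} [LieRing M] [LieAlgebra k M]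

namespace DiffLieOmega

variable {A : DiffLieOmega k lam ar L} {g : X → L} {b : Module.Basis (NLSW X ar) k L}

/-- If the Lyndon–Shirshov words are a basis of `L`, then the linear map that reads them in `M`
instead has as its graph the span of the Lyndon–Shirshov words in `L × M`. -/
theorem prod_mem_nlswSpan_iff (hb : ∀ v : NLSW X ar, b v = A.evalWord g (v : NWord X ar))
    (B : DiffLieOmega k lam ar M) (f : X → M) {φ : L →ₗ[k] M}
    (hφ : ∀ v : NLSW X ar, φ (b v) = B.evalWord f (v : NWord X ar)) (x : L) (y : M) :
    (x, y) ∈ (A.prod B).nlswSpan (fun x => (g x, f x)) ↔ φ x = y := by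
  have hp : ∀ v : NLSW X ar, (A.prod B).evalWord (fun x => (g x, f x)) (v : NWord X ar) =
      (b v, φ (b v)) := by
    intro v
    rw [evalWord_prod, hφ, hb]
  constructor
  · intro h
    have hle : (A.prod B).nlswSpan (fun x => (g x, f x)) ≤
        LinearMap.eqLocus (φ ∘ₗ LinearMap.fst k L M) (LinearMap.snd k L M) := by
      refine Submodule.span_le.2 ?_
      rintro _ ⟨v, hv, rfl⟩
      rw [hp ⟨v, hv⟩]
      rfl
    exact LinearMap.mem_eqLocus.1 (hle h)
  · rintro rfl
    have hle : ⊤ ≤ ((A.prod B).nlswSpan (fun x => (g x, f x))).comap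
        (LinearMap.id.prod φ) := by
      rw [← b.span_eq, Submodule.span_le]
      rintro _ ⟨v, rfl⟩
      have := (A.prod B).evalWord_mem_nlswSpan (fun x => (g x, f x)) v.2
      rw [hp] at this
      exact this
    exact hle (Submodule.mem_top (x := x))

/-- The homomorphism with given values on the generators is the linear map that reads
Lyndon–Shirshov words. It is a homomorphism because its graph, a span of Lyndon–Shirshov words, is
closed under all operations. -/
theorem existsUnique_isHom_of_basis (har : ∀ ω, 1 ≤ ar ω)
    (hb : ∀ v : NLSW X ar, b v = A.evalWord g (v : NWord X ar))
    (B : DiffLieOmega k lam ar M) (f : X → M) :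
    ∃! φ : L →ₗ⁅k⁆ M, A.IsHom B φ ∧ ∀ x, φ (g x) = f x := by
  have hmem := prod_mem_nlswSpan_iff hb B f (φ := b.constr k fun v => B.evalWord f v.1)
    (b.constr_basis k _)
  let φ : L →ₗ⁅k⁆ M :=
    { b.constr k (fun v => B.evalWord f v.1) with
      map_lie' := fun {x y} => (hmem ⁅x, y⁆ _).1 ((A.prod B).lie_mem_nlswSpan _ har
        ((hmem x _).2 rfl) ((hmem y _).2 rfl)) }
  have hφ : A.IsHom B φ :=
    ⟨fun x => (hmem _ _).1 ((A.prod B).D_mem_nlswSpan _ har ((hmem x _).2 rfl)),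
      fun ω a => (hmem _ _).1 ((A.prod B).op_mem_nlswSpan _ ω fun j => (hmem (a j) _).2 rfl)⟩
  have hφg : ∀ x, φ (g x) = f x := fun x => (hmem _ _).1
    ((A.prod B).evalWord_mem_nlswSpan _ (v := .of (.gen x)) (gen_mem_nlswLetters x))
  refine ⟨φ, ⟨hφ, hφg⟩, fun ψ hψ => LieHom.ext fun x => LinearMap.congr_fun
    (f := (ψ : L →ₗ[k] M)) (g := (φ : L →ₗ[k] M)) (b.ext fun v => ?_) x⟩
  have hg : (fun x => ψ (g x)) = fun x => φ (g x) := funext fun x => (hψ.2 x).trans (hφg x).symm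
  rw [hb]
  exact (hψ.1.map_evalWord g _).trans
    ((congrArg (fun h => B.evalWord h _) hg).trans (hφ.map_evalWord g _).symm)

end DiffLieOmega

variable (k lam X ar) in
/-- The Lyndon–Shirshov words as a basis of `DLie(Ω; X)`. -/
noncomputable def nlswBasis (har : ∀ ω, 1 ≤ ar ω) :
    Module.Basis (NLSW X ar) k (DLie k lam X ar) :=
  (Module.Basis.span (linearIndependent_evalWord k lam har)).map
    (LinearEquiv.ofEq _ (DLie k lam X ar).toSubmodule (by
      rw [DLie, DiffLieOmega.closure_toSubmodule _ _ har, DiffLieOmega.nlswSpan,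
        Set.image_eq_range]))

theorem coe_nlswBasis (har : ∀ ω, 1 ≤ ar ω) (v : NLSW X ar) :
    (nlswBasis k lam X ar har v : DA k X ar) =
      (lieDA k lam X ar).evalWord (genDA k) (v : NWord X ar) := by
  rw [nlswBasis, Module.Basis.map_apply]
  exact congrArg Subtype.val (Module.Basis.span_apply (linearIndependent_evalWord k lam har) v)

theorem nlswBasis_apply (har : ∀ ω, 1 ≤ ar ω) (v : NLSW X ar) :
    nlswBasis k lam X ar har v =
      (lieDLie k lam X ar).evalWord (genDLie k lam ar) (v : NWord X ar) := by
  have h := ((lieDA k lam X ar).isHom_incl (DLie k lam X ar)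
    ((lieDA k lam X ar).isClosed_closure _)).map_evalWord (genDLie k lam ar) (v : NWord X ar)
  exact Subtype.ext ((coe_nlswBasis har v).trans h.symm)

end Free

end DiffLie

theorem mainTheorem1 {k : Type w} [Field k] (lam : k)
    (X : Type u) [LinearOrder X] [WellFoundedLT X]
    {Ω : Type v} [LinearOrder Ω] [WellFoundedLT Ω] (ar : Ω → ℕ) (har : ∀ ω, 1 ≤ ar ω) :
    (∀ (L : Type z) [LieRing L] [LieAlgebra k L] (B : DiffLie.DiffLieOmega k lam ar L)
        (f : X → L),
      ∃! φ : DiffLie.DLie k lam X ar →ₗ⁅k⁆ L,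
        (DiffLie.lieDLie k lam X ar).IsHom B φ ∧ ∀ x, φ (DiffLie.genDLie k lam ar x) = f x) ∧
    ∃ b : Module.Basis (DiffLie.NLSW X ar) k (DiffLie.DLie k lam X ar),
      ∀ v : DiffLie.NLSW X ar,
        (b v : DiffLie.DA k X ar) =
          (DiffLie.lieDA k lam X ar).evalWord (DiffLie.genDA k) (v : DiffLie.NWord X ar) :=
  ⟨fun _ _ _ B f => DiffLie.DiffLieOmega.existsUnique_isHom_of_basis
      (A := DiffLie.lieDLie k lam X ar) (g := DiffLie.genDLie k lam ar)
      (b := DiffLie.nlswBasis k lam X ar har) har (DiffLie.nlswBasis_apply har) B f,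
    DiffLie.nlswBasis k lam X ar har, DiffLie.coe_nlswBasis har⟩
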